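/- **Setting.** A semilattice $E$ is a commutative idempotent semigroup with a zero element $0$; $e\le f$ means $ef=e$, and $E^\times=E\setminus\{0\}$. $\mathbb Z[E^\times]$ is the free abelian group on $E^\times$ with the ring structure $e\cdot f=ef$ if $ef\ne0$ and $e\cdot f=0$ otherwise. For $x=\sum n_\varepsilon\varepsilon\in\mathbb Z[E^\times]$ let $E(x)=\{\varepsilon: n_\varepsilon\neq 0\}$. For a finite set $\mathcal R\subseteq E$ put $\bigvee\mathcal R=\sum_{\varnothing\ne J\subseteq\mathcal R}(-1)^{|J|+1}\prod_{f\in J}f$. For $d\in E$ put $(d\mathcal R)^\times=\{df: f\in\mathcal R\}\setminus\{0\}$. A finite cover of $e\in E^\times$ is a finite set $\mathcal R\subseteq\{f\in E^\times: f\le e\}$ such that every $f\in E^\times$ with $f\le e$ satisfies $fr\ne0$ for some $r\in\mathcal R$. Let a group $\Gamma$ act on $E$ by semilattice automorphisms, and let $\mathscr R$ assign to each $e\in E^\times$ a set $\mathscr R(e)$ of finite covers of $e$ such that * (i) if $d,e\in E^\times$, $de\ne0$ and $\mathcal R\in\mathscr R(e)$, then $de\in(d\mathcal R)^\times$ or $(d\mathcal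 R)^\times\in\mathscr R(de)$; * (ii) for $e\in E^\times$, pairwise distinct $\mathcal R_1,\dots,\mathcal R_r\in\mathscr R(e)$, $\varepsilon_i\in E(\bigvee\mathcal R_i)$ and $1\le j\le r$: if $\prod_{i\ne j}\varepsilon_i\ne0$ (read as $e$ when $r=1$), then $\prod_i\varepsilon_i\lneq\prod_{i\neq j}\varepsilon_i$; * (iii) $g\cdot\mathscr R(e)=\mathscr R(g\cdot e)$ for all $g\in\Gamma$, $e\in E^\times$. For $e\in E^\times$ and a non-empty finite $\mathscr S\subseteq\mathscr R(e)$ let $e(\mathscr S)=\prod_{\mathcal R\in\mathscr S}(e-\bigvee\mathcal R)\in\mathbb Z[E^\times]$. Let $E(E,\mathscr R)$ be the semilattice of idempotents in the multiplicative subsemigroup of $\mathbb Z[E^\times]$ generated by $0$ and all $e-\bigvee\mathcal R$ ($e\in E^\times$, $\mathcal R\in\mathscr R(e)$); it consists of $0$ and the elements $e(\mathscr S)$. Let $\mathscr R(E,\mathscr R)(e(\mathscr S))$ consist of the sets $\{e(\mathscr S\cup\{\tilde{\mathcal R}\})\}\cup\{f\,e(\mathscr S): f\in\tilde{\mathcal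 R},\ f\,e(\mathscr S)\neq0\}$ for $\tilde{\mathcal R}\in\mathscr R(e)\setminus\mathscr S$. Put $E_0=E$, $\mathscr R_0=\mathscr R$, $E_{k+1}=E(E_k,\mathscr R_k)$, $\mathscr R_{k+1}=\mathscr R(E_k,\mathscr R_k)$, with the induced $\Gamma$-actions. Let $C$ be the sequence $\cdots\to\mathbb Z[\Gamma\backslash E_1^\times]\to\mathbb Z[\Gamma\backslash E_0^\times]\to0$ of free abelian groups on orbit spaces, whose maps $\partial_k:\mathbb Z[\Gamma\backslash E_k^\times]\to\mathbb Z[\Gamma\backslash E_{k-1}^\times]$ are induced by the inclusions $E_k\subseteq\mathbb Z[E_{k-1}^\times]$. Assume that $\Gamma$ acts freely on $E^\times$, and that * (A) there is $n\in\mathbb N$ with $|\mathscr R(e)|=n$ for all $e\in E^\times$; * (B) there are indexings $\mathscr R(e)=\{\mathcal R_i(e)\}_{i=1}^n$ with $g\cdot\mathcal R_i(e)=\mathcal R_i(g\cdot e)$; * (C) for all $i\ne j$ in $\{1,\dots,n\}$ there is $i\#j\in\{1,\dots,n\}$ such that $(\varepsilon\,\mathcal R_j(e))^\times=\mathcal R_{i\#j}(\varepsilon)$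 for all $e\in E^\times$ and $\varepsilon\in E(\bigvee\mathcal R_i(e))$. For a tuple $\mu=(\mu_1|\cdots|\mu_k)$ of pairwise disjoint non-empty subsets of $\{1,\dots,n\}$ define $e(\mu)\in E_k$ and $\mathcal R_p(e(\mu))$, $p\notin\bigcup_i\mu_i$, recursively: $e(\varnothing)=e$, and, writing $x=e(\mu)$, $e(\mu|\omega)=\prod_{p\in\omega}(x-\bigvee\mathcal R_p(x))$ and $\mathcal R_p(e(\mu|\omega))=\{e(\mu|\omega\cup\{p\})\}\cup(e(\mu|\omega)\,\mathcal R_p(x))^\times$. Let $x\mapsto x(\mu)$ be the homomorphism $\mathbb Z[\Gamma\backslash E^\times]\to\mathbb Z[\Gamma\backslash E_k^\times]$ with $[e](\mu)=[e(\mu)]$, and let $M_i[e]=[\bigvee\mathcal R_i(e)]$ on $\mathbb Z[\Gamma\backslash E^\times]$. A $k$-tuple of elements of $\{1,\dots,n\}$ is regarded as a tuple of singletons. Let $N^n_k$ be the set of strictly increasing $k$-tuples in $\{1,\dots,n\}$. For $\mu\in N^n_k$ let $\mu^i$ be $\mu$ with its $i$-th entry removed and $\mu_i\#\mu^i$ the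 tuple of all $\mu_i\#\mu_j$, $j\ne i$, in the given order. For a permutation $\sigma\in S_k$ put $\sigma(\mu)=(\mu_{\sigma(1)}|\cdots|\mu_{\sigma(k)})$, and let $m(\sigma)$ be its number of inversions. Let $\rho_{\mu,i}\in S_{k-1}$ be the permutation with $\rho_{\mu,i}(\mu_i\#\mu^i)\in N^n_{k-1}$. (When $E^\times\neq\varnothing$, $\rho_{\mu,i}$ exists and is unique; when $E^\times=\varnothing$ all groups below vanish.) Let $\widetilde C$ be the sequence with groups $\widetilde C_k=\bigoplus_{\mu\in N^n_k}\mathbb Z[\Gamma\backslash E^\times]$ (zero for $k>n$) and maps $d_k:\widetilde C_k\to\widetilde C_{k-1}$, $$d_k\Big(\bigoplus_\mu x_\mu\Big)=\bigoplus_{\lambda\in N^n_{k-1}}\sum_{\mu\in N^n_k}\sum_{i=1}^k(-1)^{i+1}\Big(\delta_{\lambda,\mu^i}+(-1)^{m(\rho_{\mu,i})+1}\delta_{\lambda,\rho_{\mu,i}(\mu_i\#\mu^i)}M_{\mu_i}\Big)x_\mu .$$ Let $a_0=0$, $a_k=a_{k-1}+k-1$, and define $f_k:\widetilde C_k\to\mathbb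 Z[\Gamma\backslash E_k^\times]$ by $$f_k\Big(\bigoplus_\mu x_\mu\Big)=\sum_{\mu\in N^n_k}\sum_{\sigma\in S_k}(-1)^{m(\sigma)+a_k}\,x_\mu(\sigma(\mu)),$$ so that $f_0$ is the identity of $\mathbb Z[\Gamma\backslash E^\times]$. **Proposition.** $\widetilde C$ is a chain complex ($d_kd_{k+1}=0$ for all $k\ge1$), $C$ is a chain complex ($\partial_k\partial_{k+1}=0$ for all $k\ge1$), and the homomorphisms $f_k$ form a chain map $\widetilde C\to C$: $\partial_kf_k=f_{k-1}d_k$ for all $k\ge1$. -/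

import Mathlib

noncomputable section

namespace IndRes

open scoped Classical

universe u v w

/-! ### The ring `ℤ[E^×]` of a semilattice with zero

A semilattice with zero is a `SemilatticeInf` with an `OrderBot`: the product `e f` is the meet
`e ⊓ f`, the zero element is `⊥`, and `e ≤ f` means `e f = e`. -/

section Ring

variable (E : Type u) [SemilatticeInf E] [OrderBot E]

/-- `E^× = E \ {0}`. -/
abbrev Pos : Type u := {e : E // e ≠ ⊥}

/-- The free abelian group `ℤ[E^×]` on `E^×` (a type synonym, since `Finsupp` already carries a
different, pointwise, multiplication). -/
def Zx : Type u := Pos E →₀ ℤ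

instance : AddCommGroup (Zx E) := inferInstanceAs (AddCommGroup (Pos E →₀ ℤ))

variable {E}

/-- The element `e` of `ℤ[E^×]`; the zero of `E` is sent to `0`. -/
def of (e : E) : Zx E := if h : e ≠ ⊥ then (Finsupp.single (⟨e, h⟩ : Pos E) (1 : ℤ)) else 0

/-- The support `E(x)` of an element `x = ∑ n_ε ε` of `ℤ[E^×]`. -/
def supp (x : Zx E) : Finset (Pos E) := Finsupp.support (x : Pos E →₀ ℤ)

/-- The additive extension of a map defined on the basis `E^×`. -/
def lift {M : Type w} [AddCommGroup M] (φ : Pos E → M) : Zx E →+ M :=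
  (Finsupp.liftAddHom (fun e => zmultiplesHom M (φ e)) : (Pos E →₀ ℤ) →+ M)

theorem of_bot : of (⊥ : E) = 0 := by simp [of]

theorem of_pos (e : Pos E) : of (e : E) = Finsupp.single e (1 : ℤ) :=
  dif_pos e.2

theorem lift_of {M : Type w} [AddCommGroup M] (φ : Pos E → M) (e : Pos E) :
    lift φ (of (e : E)) = φ e := by
  rw [of_pos]
  simp only [lift]
  erw [Finsupp.liftAddHom_apply_single]
  simp

theorem addHom_ext {M : Type w} [AddCommGroup M] {φ ψ : Zx E →+ M}
    (h : ∀ e : Pos E, φ (of (e : E)) = ψ (of (e : E))) : φ = ψ := by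
  apply Finsupp.addHom_ext' (f := φ) (g := ψ)
  intro e
  apply AddMonoidHom.ext_int
  have := h e
  rw [of_pos] at this
  exact this

/-- The multiplication of `ℤ[E^×]`: the biadditive extension of `e · f = ef` if `ef ≠ 0` and
`e · f = 0` otherwise. -/
def mulHom : Zx E →+ Zx E →+ Zx E :=
  lift fun e => lift fun f => of ((e : E) ⊓ (f : E))

instance : Mul (Zx E) := ⟨fun x y => mulHom x y⟩

theorem mul_def (x y : Zx E) : x * y = mulHom x y := rfl

theorem of_mul_of (e f : E) : of e * of f = of (e ⊓ f) := by
  by_cases he : e = ⊥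
  · subst he; simp [mul_def, of_bot]
  by_cases hf : f = ⊥
  · subst hf; simp [mul_def, of_bot]
  have h1 := lift_of (fun e : Pos E => lift fun f : Pos E => of ((e : E) ⊓ (f : E))) ⟨e, he⟩
  have h2 := lift_of (fun f' : Pos E => of (e ⊓ (f' : E))) ⟨f, hf⟩
  simp only at h1 h2
  rw [mul_def, mulHom, h1, h2]

theorem mulHom_comm (x y : Zx E) : mulHom x y = mulHom y x := by
  have : (mulHom : Zx E →+ Zx E →+ Zx E) = AddMonoidHom.flip mulHom := by
    apply addHom_ext; intro e
    apply addHom_ext; intro f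
    have h1 := of_mul_of (e : E) (f : E)
    have h2 := of_mul_of (f : E) (e : E)
    rw [mul_def] at h1 h2
    rw [AddMonoidHom.flip_apply, h1, h2, inf_comm]
  conv_lhs => rw [this]
  rfl

theorem mulHom_assoc (x y z : Zx E) : mulHom (mulHom x y) z = mulHom x (mulHom y z) := by
  have key : ∀ e f : Pos E, ∀ z : Zx E,
      mulHom (mulHom (of (e : E)) (of (f : E))) z
        = mulHom (of (e : E)) (mulHom (of (f : E)) z) := by
    intro e f z
    have : mulHom (mulHom (of (e : E)) (of (f : E)))
        = (mulHom (of (e : E))).comp (mulHom (of (f : E))) := by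
      apply addHom_ext; intro g
      simp only [AddMonoidHom.comp_apply, ← mul_def, of_mul_of, inf_assoc]
    rw [this]; rfl
  have key2 : ∀ e : Pos E, ∀ y z : Zx E,
      mulHom (mulHom (of (e : E)) y) z = mulHom (of (e : E)) (mulHom y z) := by
    intro e y z
    have : ((mulHom : Zx E →+ Zx E →+ Zx E).flip z).comp (mulHom (of (e : E)))
        = (mulHom (of (e : E))).comp ((mulHom : Zx E →+ Zx E →+ Zx E).flip z) := by
      apply addHom_ext; intro f
      simpa using key e f z
    exact DFunLike.congr_fun this y
  have : ((mulHom : Zx E →+ Zx E →+ Zx E).flip z).comp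
        ((mulHom : Zx E →+ Zx E →+ Zx E).flip y)
      = (mulHom : Zx E →+ Zx E →+ Zx E).flip (mulHom y z) := by
    apply addHom_ext; intro e
    simpa using key2 e y z
  exact DFunLike.congr_fun this x

/-- `ℤ[E^×]` as a commutative ring (without unit in general). -/
instance : NonUnitalCommRing (Zx E) :=
  { (inferInstance : AddCommGroup (Zx E)) with
    mul := (· * ·)
    left_distrib := fun x y z => map_add (mulHom x) y z
    right_distrib := fun x y z => by
      show mulHom (x + y) z = mulHom x z + mulHom y z
      simp
    zero_mul := fun x => by
      show mulHom 0 x = 0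
      simp
    mul_zero := fun x => map_zero (mulHom x)
    mul_assoc := mulHom_assoc
    mul_comm := mulHom_comm }

/-- `⋁ R = ∑_{∅ ≠ J ⊆ R} (-1)^(|J|+1) ∏_{f ∈ J} f` in `ℤ[E^×]`. -/
def join (R : Finset E) : Zx E :=
  ∑ J ∈ R.powerset,
    if h : J.Nonempty then (-1 : ℤ) ^ (J.card + 1) • of (J.inf' h id) else 0

/-- The product `∏_{i ∈ s} (e - ⋁ (c i))` in `ℤ[E^×]`, for `s` non-empty and sets `c i` of elements
below `e`. (The redundant leading factor `e`, a unit for the other factors, is there because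
`ℤ[E^×]` need not have a unit.) -/
def cut {ι : Type w} (e : E) (c : ι → Finset E) (s : Finset ι) : Zx E :=
  s.fold (· * ·) (of e) (fun i => of e - join (c i))

/-- With `y = ∏_{j ∈ s} (e - ⋁ (c j))`, the set
`{∏_{j ∈ s ∪ {i}} (e - ⋁ (c j))} ∪ {f · y | f ∈ c i, f · y ≠ 0}`. -/
def cutCover {ι : Type w} [DecidableEq ι] (e : E) (c : ι → Finset E) (s : Finset ι) (i : ι) : Finset (Zx E) :=
  insert (cut e c (insert i s)) (((c i).image fun f => of f * cut e c s).erase 0)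

/-- The product of the `ε i`, `i ∈ s`, where the empty product is `e`. -/
def prodFrom {ι : Type w} (e : E) (s : Finset ι) (ε : ι → E) : E :=
  if h : s.Nonempty then s.inf' h ε else e

/-- A finite cover of `e`. -/
def IsFiniteCover (e : E) (R : Finset E) : Prop :=
  (∀ f ∈ R, f ≠ ⊥ ∧ f ≤ e) ∧ ∀ f : E, f ≠ ⊥ → f ≤ e → ∃ r ∈ R, f ⊓ r ≠ ⊥

/-- `(d · R)^×`. -/
def mulCover (d : E) (R : Finset E) : Finset E := (R.image fun f => d ⊓ f).erase ⊥

end Ring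

/-! ### Semilattices with an action of a group and an invariant collection of finite subsets -/

/-- A `Γ`-semilattice `E` together with a collection `𝓡(e)`, `e ∈ E^×`, of sets of finite subsets
of `E` such that `τ_g(𝓡(e)) = 𝓡(τ_g(e))`. The value of `cover` at `⊥` plays no role. -/
structure CoverData (Γ : Type v) [Group Γ] where
  E : Type u
  [semilattice : SemilatticeInf E]
  [orderBot : OrderBot E]
  [action : MulAction Γ E]
  smul_inf : ∀ (g : Γ) (x y : E), g • (x ⊓ y) = (g • x) ⊓ (g • y)
  cover : E → Set (Finset E)
  smul_cover : ∀ (g : Γ) (e : E), e ≠ ⊥ →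
    cover (g • e) = (fun R : Finset E => R.image fun f => g • f) '' cover e

attribute [instance] CoverData.semilattice CoverData.orderBot CoverData.action

section Action

variable {Γ : Type v} [Group Γ] (D : CoverData.{u} Γ)

theorem smul_bot' (g : Γ) : g • (⊥ : D.E) = ⊥ := by
  have h : g • ((g⁻¹ • (⊥ : D.E)) ⊓ ⊥) = (g • (g⁻¹ • (⊥ : D.E))) ⊓ (g • (⊥ : D.E)) :=
    D.smul_inf g _ _
  rw [inf_bot_eq, smul_inv_smul, bot_inf_eq] at h
  exact h

theorem smul_ne_bot {g : Γ} {e : D.E} (h : e ≠ ⊥) : g • e ≠ ⊥ := by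
  intro h'
  apply h
  have := congrArg (fun x => g⁻¹ • x) h'
  simpa [smul_bot'] using this

/-- The action of `Γ` on `E^×`. -/
instance : MulAction Γ (Pos D.E) where
  smul g e := ⟨g • (e : D.E), smul_ne_bot D e.2⟩
  one_smul e := Subtype.ext (one_smul Γ (e : D.E))
  mul_smul g h e := Subtype.ext (mul_smul g h (e : D.E))

theorem coe_smul (g : Γ) (e : Pos D.E) : ((g • e : Pos D.E) : D.E) = g • (e : D.E) := rfl

/-- The action of `g ∈ Γ` on `ℤ[E^×]`. -/
def act (g : Γ) : Zx D.E →+ Zx D.E := lift fun e => of (g • (e : D.E))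

theorem act_of (g : Γ) (e : D.E) : act D g (of e) = of (g • e) := by
  by_cases h : e = ⊥
  · subst h; simp [smul_bot', of_bot]
  · exact lift_of (fun e : Pos D.E => of (g • (e : D.E))) ⟨e, h⟩

theorem act_mul (g : Γ) (x y : Zx D.E) : act D g (x * y) = act D g x * act D g y := by
  have key : ∀ e : Pos D.E, ∀ y : Zx D.E,
      act D g (of (e : D.E) * y) = act D g (of (e : D.E)) * act D g y := by
    intro e y
    have : (act D g).comp (mulHom (of (e : D.E)))
        = (mulHom (act D g (of (e : D.E)))).comp (act D g) := by
      apply addHom_ext; intro f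
      simp only [AddMonoidHom.comp_apply, ← mul_def, of_mul_of, act_of, D.smul_inf]
    exact DFunLike.congr_fun this y
  have : (act D g).comp ((mulHom : Zx D.E →+ Zx D.E →+ Zx D.E).flip y)
      = ((mulHom : Zx D.E →+ Zx D.E →+ Zx D.E).flip (act D g y)).comp (act D g) := by
    apply addHom_ext; intro e
    simpa [mul_def] using key e y
  exact DFunLike.congr_fun this x

theorem act_one (x : Zx D.E) : act D (1 : Γ) x = x := by
  have : act D (1 : Γ) = AddMonoidHom.id _ := by
    apply addHom_ext; intro e; simp [act_of]
  rw [this]; rfl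

theorem act_act (g h : Γ) (x : Zx D.E) : act D (g * h) x = act D g (act D h x) := by
  have : act D (g * h) = (act D g).comp (act D h) := by
    apply addHom_ext; intro e; simp [act_of, mul_smul]
  rw [this]; rfl

theorem act_injective (g : Γ) : Function.Injective (act D g) := by
  intro x y h
  have := congrArg (act D g⁻¹) h
  simpa [← act_act, act_one] using this

/-- The translate `g · R` of a finite set. -/
def tr (g : Γ) (R : Finset D.E) : Finset D.E := R.image fun f => g • f

theorem tr_injective (g : Γ) : Function.Injective (tr D g) :=
  Finset.image_injective (MulAction.injective g)

theorem act_join (g : Γ) (R : Finset D.E) : act D g (join R) = join (tr D g R) := by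
  unfold join tr
  rw [map_sum, Finset.powerset_image, Finset.sum_image
    (fun _ _ _ _ h => Finset.image_injective (MulAction.injective g) h)]
  refine Finset.sum_congr rfl fun J _ => ?_
  by_cases hJ : J.Nonempty
  · have hJ' : (J.image fun f => g • f).Nonempty := hJ.image _
    rw [dif_pos hJ, dif_pos hJ', map_zsmul, act_of,
      Finset.card_image_of_injective _ (MulAction.injective g)]
    congr 2
    rw [Finset.inf'_image]
    exact Finset.apply_inf'_eq_inf'_comp hJ (fun f : D.E => g • f) (D.smul_inf g)
  · have hJ' : ¬ (J.image fun f => g • f).Nonempty := by simpa using hJ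
    rw [dif_neg hJ, dif_neg hJ', map_zero]

theorem act_cut {ι : Type w} (g : Γ) (e : D.E) (c : ι → Finset D.E) (s : Finset ι) :
    act D g (cut e c s) = cut (g • e) (fun i => tr D g (c i)) s := by
  unfold cut
  rw [← Finset.fold_hom (op := (· * ·)) (op' := (· * ·)) (m := act D g) (act_mul D g), act_of]
  simp only [map_sub, act_of, act_join]

theorem act_cutCover {ι : Type w} [DecidableEq ι] (g : Γ) (e : D.E) (c : ι → Finset D.E) (s : Finset ι) (i : ι) :
    (cutCover e c s i).image (act D g) = cutCover (g • e) (fun j => tr D g (c j)) s i := by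
  unfold cutCover
  rw [Finset.image_insert, act_cut, Finset.image_erase (act_injective D g), map_zero]
  congr 2
  simp only [tr]
  rw [Finset.image_image, Finset.image_image]
  apply Finset.image_congr
  intro f _
  simp only [Function.comp, act_mul, act_of, act_cut]
  rfl

theorem cut_tr (g : Γ) (e : D.E) (S : Finset (Finset D.E)) :
    cut e (fun R => tr D g R) S = cut e id (S.image (tr D g)) := by
  unfold cut
  rw [Finset.fold_image (fun _ _ _ _ h => tr_injective D g h)]
  rfl

theorem cutCover_tr (g : Γ) (e : D.E) (S : Finset (Finset D.E)) (R : Finset D.E) :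
    cutCover e (fun R => tr D g R) S R = cutCover e id (S.image (tr D g)) (tr D g R) := by
  unfold cutCover
  rw [cut_tr, cut_tr, Finset.image_insert]
  rfl

end Action

/-! ### The semilattice `E(E, 𝓡)` and its collection of covers `𝓡(E, 𝓡)` -/

section Next

variable {Γ : Type v} [Group Γ] (D : CoverData.{u} Γ)

/-- The elements `e - ⋁ R` with `e ∈ E^×`, `R ∈ 𝓡(e)`, and `0`. -/
def gens : Set (Zx D.E) :=
  {x | x = 0 ∨ ∃ e : D.E, e ≠ ⊥ ∧ ∃ R ∈ D.cover e, x = of e - join R}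

/-- `E(E, 𝓡)` as a set of idempotents of `ℤ[E^×]`: the idempotents in the subsemigroup generated by
`0` and the elements `e - ⋁ R`. (These elements are idempotent as soon as the members of `R` lie
below `e`. Under the conditions (i) and (ii) below, the resulting set consists of `0` and the
products `∏_{R ∈ S} (e - ⋁ R)` with `∅ ≠ S ⊆ 𝓡(e)` finite.) -/
def nextSet : Set (Zx D.E) := {x | x * x = x ∧ x ∈ Subsemigroup.closure (gens D)}

theorem zero_mem_nextSet : (0 : Zx D.E) ∈ nextSet D :=
  ⟨mul_zero 0, Subsemigroup.subset_closure (Or.inl rfl)⟩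

theorem mul_mem_nextSet {x y : Zx D.E} (hx : x ∈ nextSet D) (hy : y ∈ nextSet D) :
    x * y ∈ nextSet D :=
  ⟨by rw [mul_mul_mul_comm, hx.1, hy.1], Subsemigroup.mul_mem _ hx.2 hy.2⟩

theorem act_mem_nextSet (g : Γ) {x : Zx D.E} (hx : x ∈ nextSet D) : act D g x ∈ nextSet D := by
  refine ⟨by rw [← act_mul, hx.1], ?_⟩
  refine Subsemigroup.closure_induction
    (p := fun x _ => act D g x ∈ Subsemigroup.closure (gens D)) ?_ ?_ hx.2
  · rintro y (rfl | ⟨e, he, R, hR, rfl⟩)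
    · rw [map_zero]; exact Subsemigroup.subset_closure (Or.inl rfl)
    · refine Subsemigroup.subset_closure (Or.inr ⟨g • e, smul_ne_bot D he, tr D g R, ?_, ?_⟩)
      · rw [D.smul_cover g e he]; exact ⟨R, hR, rfl⟩
      · rw [map_sub, act_of, act_join]
  · intro a b _ _ ha hb
    rw [act_mul]; exact Subsemigroup.mul_mem _ ha hb

/-- The carrier of `E(E, 𝓡)`. -/
@[ext] structure Next : Type u where
  val : Zx D.E
  property : val ∈ nextSet D

instance : Min (Next D) := ⟨fun x y => ⟨x.val * y.val, mul_mem_nextSet D x.property y.property⟩⟩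

/-- `E(E, 𝓡)` with the product of `ℤ[E^×]` as its semilattice product. -/
instance : SemilatticeInf (Next D) :=
  SemilatticeInf.mk' (fun x y => Next.ext (mul_comm x.val y.val))
    (fun x y z => Next.ext (mul_assoc x.val y.val z.val))
    (fun x => Next.ext x.property.1)

theorem Next.coe_inf (x y : Next D) : (x ⊓ y).val = x.val * y.val := rfl

instance : OrderBot (Next D) where
  bot := ⟨0, zero_mem_nextSet D⟩
  bot_le x := by
    rw [← inf_eq_left]
    exact Next.ext (zero_mul x.val)

theorem Next.coe_bot : (⊥ : Next D).val = 0 := rfl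

instance : MulAction Γ (Next D) where
  smul g x := ⟨act D g x.val, act_mem_nextSet D g x.property⟩
  one_smul x := Next.ext (act_one D x.val)
  mul_smul g h x := Next.ext (act_act D g h x.val)

theorem Next.coe_smul (g : Γ) (x : Next D) : (g • x).val = act D g x.val := rfl

/-- A finite subset of `E(E, 𝓡) ⊆ ℤ[E^×]`, as a finite set of elements of `E(E, 𝓡)`. -/
def toNextSet (F : Finset (Zx D.E)) : Finset (Next D) :=
  (F.subtype (· ∈ nextSet D)).image fun y => ⟨y.1, y.2⟩

theorem mem_toNextSet {F : Finset (Zx D.E)} {y : Next D} : y ∈ toNextSet D F ↔ y.val ∈ F := by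
  simp only [toNextSet, Finset.mem_image, Finset.mem_subtype]
  constructor
  · rintro ⟨x, hx, rfl⟩
    exact hx
  · intro hy
    exact ⟨⟨y.val, y.property⟩, hy, rfl⟩

/-- An element of `E(E, 𝓡) ⊆ ℤ[E^×]`, as an element of `E(E, 𝓡)` (by convention `⊥` if the given
element of `ℤ[E^×]` is not in `E(E, 𝓡)`). -/
def toNext (x : Zx D.E) : Next D := if h : x ∈ nextSet D then ⟨x, h⟩ else ⊥

theorem mem_nextSet_of_act {g : Γ} {x : Zx D.E} (h : act D g x ∈ nextSet D) : x ∈ nextSet D := by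
  have := act_mem_nextSet D g⁻¹ h
  rwa [← act_act, inv_mul_cancel, act_one] at this

theorem smul_toNextSet (g : Γ) (F : Finset (Zx D.E)) :
    (toNextSet D F).image (fun x => g • x) = toNextSet D (F.image (act D g)) := by
  ext y
  simp only [mem_toNextSet, Finset.mem_image]
  constructor
  · rintro ⟨x, hx, rfl⟩
    exact ⟨x.val, hx, rfl⟩
  · rintro ⟨x, hx, hxy⟩
    refine ⟨⟨x, mem_nextSet_of_act D (g := g) (by rw [hxy]; exact y.property)⟩, hx, Next.ext hxy⟩

theorem smul_toNext (g : Γ) (x : Zx D.E) : g • toNext D x = toNext D (act D g x) := by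
  unfold toNext
  by_cases h : x ∈ nextSet D
  · rw [dif_pos h, dif_pos (act_mem_nextSet D g h)]; rfl
  · rw [dif_neg h, dif_neg (fun h' => h (mem_nextSet_of_act D h'))]
    exact Next.ext (map_zero (act D g))

/-- The collection `𝓡(E, 𝓡)`: writing `e(S) = ∏_{R ∈ S} (e - ⋁ R)`, the set `𝓡(E, 𝓡)(e(S))` consists
of the sets `{e(S ∪ {R})} ∪ {f · e(S) | f ∈ R, f · e(S) ≠ 0}` with `R ∈ 𝓡(e) \ S`. -/
def nextCover (x : Next D) : Set (Finset (Next D)) :=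
  {T | ∃ e : D.E, e ≠ ⊥ ∧ ∃ S : Finset (Finset D.E), S.Nonempty ∧ (∀ R ∈ S, R ∈ D.cover e) ∧
    x.val = cut e id S ∧ ∃ R ∈ D.cover e, R ∉ S ∧ T = toNextSet D (cutCover e id S R)}

theorem nextCover_smul_subset (g : Γ) (x : Next D) (T : Finset (Next D)) (hT : T ∈ nextCover D x) :
    (T.image fun y => g • y) ∈ nextCover D (g • x) := by
  obtain ⟨e, he, S, hS, hSc, hx, R, hR, hRS, rfl⟩ := hT
  refine ⟨g • e, smul_ne_bot D he, S.image (tr D g), hS.image _, ?_, ?_, tr D g R, ?_, ?_, ?_⟩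
  · intro R' hR'
    obtain ⟨R'', h, rfl⟩ := Finset.mem_image.1 hR'
    rw [D.smul_cover g e he]
    exact ⟨R'', hSc _ h, rfl⟩
  · rw [Next.coe_smul, hx, act_cut, ← cut_tr]
    rfl
  · rw [D.smul_cover g e he]; exact ⟨R, hR, rfl⟩
  · intro h
    obtain ⟨R'', h, h'⟩ := Finset.mem_image.1 h
    exact hRS (tr_injective D g h' ▸ h)
  · rw [smul_toNextSet, act_cutCover, ← cutCover_tr]
    rfl

/-- The `Γ`-semilattice `E(E, 𝓡)` together with `𝓡(E, 𝓡)`. -/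
def CoverData.next : CoverData.{u} Γ where
  E := Next D
  smul_inf g x y := Next.ext (act_mul D g x.val y.val)
  cover := nextCover D
  smul_cover g x _ := by
    apply Set.Subset.antisymm
    · intro T hT
      refine ⟨T.image fun y => g⁻¹ • y, ?_, ?_⟩
      · have := nextCover_smul_subset D g⁻¹ _ T hT
        rwa [inv_smul_smul] at this
      · simp [Finset.image_image, Function.comp_def]
    · rintro _ ⟨T, hT, rfl⟩
      exact nextCover_smul_subset D g x T hT

/-- `(E_k, 𝓡_k)`, with `E_0 = E`, `𝓡_0 = 𝓡`, `E_{k+1} = E(E_k, 𝓡_k)`, `𝓡_{k+1} = 𝓡(E_k, 𝓡_k)`. -/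
def CoverData.level : ℕ → CoverData.{u} Γ
  | 0 => D
  | k + 1 => (CoverData.level k).next

end Next

/-! ### The chain complex `C` -/

section Orbits

variable {Γ : Type v} [Group Γ] (D : CoverData.{u} Γ)

/-- The orbit space `Γ \ E^×`. -/
abbrev Orb : Type u := MulAction.orbitRel.Quotient Γ (Pos D.E)

/-- The free abelian group `ℤ[Γ \ E^×]`. -/
abbrev ZOrb : Type u := Orb D →₀ ℤ

/-- The homomorphism `ℤ[E^×] → ℤ[Γ \ E^×]`, `e ↦ [e]`. -/
def cls : Zx D.E →+ ZOrb D := lift fun e => Finsupp.single (Quotient.mk'' e : Orb D) (1 : ℤ)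

theorem cls_act (g : Γ) (x : Zx D.E) : cls D (act D g x) = cls D x := by
  have : (cls D).comp (act D g) = cls D := by
    apply addHom_ext; intro e
    rw [AddMonoidHom.comp_apply, act_of, ← coe_smul, cls, lift_of, lift_of]
    congr 1
    exact Quotient.sound' ⟨g, rfl⟩
  exact DFunLike.congr_fun this x

/-- The homomorphism `ℤ[Γ \ E^×] → M`, `[e] ↦ φ e`, for an invariant map `φ` on `E^×`. -/
def orbLift {M : Type w} [AddCommGroup M] (φ : Pos D.E → M)
    (hφ : ∀ (g : Γ) (e : Pos D.E), φ (g • e) = φ e) : ZOrb D →+ M :=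
  Finsupp.liftAddHom fun o => zmultiplesHom M
    (Quotient.lift φ (fun a b (h : a ∈ MulAction.orbit Γ b) => by
      obtain ⟨g, rfl⟩ := h
      exact hφ g b) o)

/-- The homomorphism `ℤ[Γ \ E(E, 𝓡)^×] → ℤ[Γ \ E^×]` induced by the inclusion
`E(E, 𝓡) ⊆ ℤ[E^×]`. -/
def bdry : ZOrb D.next →+ ZOrb D :=
  orbLift D.next (fun x => cls D x.1.val) (fun g x => cls_act D g x.1.val)

/-- The boundary map `∂_{k+1} : ℤ[Γ \ E_{k+1}^×] → ℤ[Γ \ E_k^×]` of `C`. -/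
def bdryC (k : ℕ) : ZOrb (D.level (k + 1)) →+ ZOrb (D.level k) := bdry (D.level k)

end Orbits

/-! ### The conditions on the covers -/

section Conditions

variable {Γ : Type v} [Group Γ] (D : CoverData.{u} Γ)

/-- The sets in `𝓡(e)` are finite covers of `e`, and conditions (i) and (ii) hold. (Condition (iii),
`τ_g(𝓡(e)) = 𝓡(τ_g(e))`, is part of `CoverData`.) -/
structure IsCoverSystem : Prop where
  finite_cover : ∀ e : D.E, e ≠ ⊥ → ∀ R ∈ D.cover e, IsFiniteCover e R
  /-- (i) If `d e ≠ 0` and `R ∈ 𝓡(e)`, then `d e ∈ (d R)^×` or `(d R)^× ∈ 𝓡(d e)`. -/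
  cond_i : ∀ d e : D.E, d ⊓ e ≠ ⊥ → ∀ R ∈ D.cover e,
    d ⊓ e ∈ mulCover d R ∨ mulCover d R ∈ D.cover (d ⊓ e)
  /-- (ii) For distinct members `R` of `𝓡(e)`, forming a finite set `S`, and a choice of elements
  `ε_R` in the support of `⋁ R`, for each `Q ∈ S`: if `∏_{R ≠ Q} ε_R ≠ 0` (the empty product being
  `e`), then `∏_R ε_R` is strictly smaller than it. -/
  cond_ii : ∀ e : D.E, e ≠ ⊥ → ∀ S : Finset (Finset D.E), (∀ R ∈ S, R ∈ D.cover e) →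
    ∀ ε : Finset D.E → Pos D.E, (∀ R ∈ S, ε R ∈ supp (join R)) → ∀ Q ∈ S,
      prodFrom e (S.erase Q) (fun R => (ε R : D.E)) ≠ ⊥ →
        prodFrom e S (fun R => (ε R : D.E)) < prodFrom e (S.erase Q) (fun R => (ε R : D.E))

/-- `Γ` acts freely on `E^×`. -/
def ActsFreely : Prop := ∀ (g : Γ) (e : D.E), e ≠ ⊥ → g • e = e → g = 1

/-- The conditions (A), (B), (C): each `𝓡(e)` has exactly `n` elements, indexed compatibly with the
`Γ`-action and with products. In (C), `(ε · R_j(e))^× = R_{i # j}(ε)`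
for `ε` in the support of `⋁ R_i(e)`. -/
structure UniformIndexing (n : ℕ) where
  /-- The indexing `R i e = R_i(e)`; its value at `e = ⊥` plays no role. -/
  R : Fin n → D.E → Finset D.E
  injective : ∀ e : D.E, e ≠ ⊥ → Function.Injective fun i => R i e
  range_eq : ∀ e : D.E, e ≠ ⊥ → Set.range (fun i => R i e) = D.cover e
  smul_eq : ∀ (i : Fin n) (g : Γ) (e : D.E), e ≠ ⊥ → R i (g • e) = tr D g (R i e)
  /-- The index `i # j`, which matters only for `i ≠ j`. -/
  sharp : Fin n → Fin n → Fin n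
  sharp_spec : ∀ i j : Fin n, i ≠ j → ∀ e : D.E, e ≠ ⊥ → ∀ ε ∈ supp (join (R i e)),
    mulCover (ε : D.E) (R j e) = R (sharp i j) ε

end Conditions

/-! ### The elements `e(μ)` -/

section Tuples

variable {Γ : Type v} [Group Γ] {D : CoverData.{u} Γ} {n : ℕ}

/-- For a tuple `μ = (μ_1 | ... | μ_k)` of subsets of `{1, ..., n}`, the element `e(μ)` of `E_k` and
the sets `R_p(e(μ))`, given by `e(∅) = e`, `R_p(e(∅)) = R_p(e)` and, with `x = e(μ_1 | ... | μ_k)`,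
`e(μ_1 | ... | μ_{k+1}) = ∏_{p ∈ μ_{k+1}} (x - ⋁ R_p(x))`,
`R_p(e(μ_1 | ... | μ_{k+1})) =
  {e(μ_1 | ... | μ_{k+1} ∪ {p})} ∪ (e(μ_1 | ... | μ_{k+1}) · R_p(x))^×`. -/
def evalAux (R : Fin n → D.E → Finset D.E) (e : D.E) : (k : ℕ) → (Fin k → Finset (Fin n)) →
    (D.level k).E × (Fin n → Finset (D.level k).E)
  | 0, _ => (e, fun p => R p e)
  | k + 1, μ =>
    let x := (evalAux R e k (Fin.init μ)).1
    let c := (evalAux R e k (Fin.init μ)).2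
    (toNext (D.level k) (cut x c (μ (Fin.last k))),
      fun p => toNextSet (D.level k) (cutCover x c (μ (Fin.last k)) p))

theorem evalAux_smul (I : UniformIndexing D n) (g : Γ) (e : D.E) (he : e ≠ ⊥) (k : ℕ)
    (μ : Fin k → Finset (Fin n)) :
    (evalAux I.R (g • e) k μ).1 = g • (evalAux I.R e k μ).1 ∧
      (evalAux I.R (g • e) k μ).2 = fun p => tr (D.level k) g ((evalAux I.R e k μ).2 p) := by
  induction k with
  | zero =>
    refine ⟨rfl, ?_⟩
    funext p
    exact I.smul_eq p g e he
  | succ k ih =>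
    obtain ⟨h1, h2⟩ := ih (Fin.init μ)
    constructor
    · show toNext (D.level k) _ = g • toNext (D.level k) _
      rw [smul_toNext, act_cut, h1, h2]
    · funext p
      show toNextSet (D.level k) _ = (toNextSet (D.level k) _).image (fun x => g • x)
      rw [smul_toNextSet, act_cutCover, h1, h2]

/-- The homomorphism `ℤ[Γ \ E^×] → ℤ[Γ \ E_k^×]`, `x ↦ x(μ)`, given by `[e](μ) = [e(μ)]`. -/
def evalOrb (I : UniformIndexing D n) (k : ℕ) (μ : Fin k → Finset (Fin n)) :
    ZOrb D →+ ZOrb (D.level k) :=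
  orbLift D (fun e => cls (D.level k) (of (evalAux I.R (e : D.E) k μ).1)) (fun g e => by
    rw [coe_smul, (evalAux_smul I g (e : D.E) e.2 k μ).1, ← act_of, cls_act])

end Tuples

/-! ### The complex `C̃` and the maps `f_k` -/

section Ctilde

variable {Γ : Type v} [Group Γ] {D : CoverData.{u} Γ} {n : ℕ}

/-- The operator `M_i` on `ℤ[Γ \ E^×]`, `M_i [e] = [⋁ R_i(e)]`. -/
def opM (I : UniformIndexing D n) (i : Fin n) : ZOrb D →+ ZOrb D :=
  orbLift D (fun e => cls D (join (I.R i (e : D.E)))) (fun g e => by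
    rw [coe_smul, I.smul_eq i g (e : D.E) e.2, ← act_join, cls_act])

/-- `N^n_k`: the strictly increasing `k`-tuples in `{1, ..., n}`. -/
abbrev NTuple (n k : ℕ) : Type := {μ : Fin k → Fin n // StrictMono μ}

/-- The `k`-th group `⨁_{μ ∈ N^n_k} ℤ[Γ \ E^×]` of `C̃`. -/
abbrev Ct (D : CoverData.{u} Γ) (n k : ℕ) : Type u := NTuple n k → ZOrb D

/-- `μ^i`: the tuple `μ` with its `i`-th entry removed. -/
def omit' {k : ℕ} (μ : Fin (k + 1) → Fin n) (i : Fin (k + 1)) : Fin k → Fin n :=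
  fun j => μ (i.succAbove j)

/-- `μ_i # μ^i`. -/
def sharpOmit (I : UniformIndexing D n) {k : ℕ} (μ : Fin (k + 1) → Fin n) (i : Fin (k + 1)) :
    Fin k → Fin n :=
  fun j => I.sharp (μ i) (omit' μ i j)

/-- `ρ_{μ,i}`: the permutation that sorts `μ_i # μ^i` into increasing order, where a permutation `σ`
turns a tuple `t` into `(t_{σ(1)}, ..., t_{σ(k)})`. -/
def rho (I : UniformIndexing D n) {k : ℕ} (μ : Fin (k + 1) → Fin n) (i : Fin (k + 1)) :
    Equiv.Perm (Fin k) :=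
  Tuple.sort (sharpOmit I μ i)

/-- The connecting map `d_{k+1}` of `C̃`. The index `i` starts from `0` here, so that the sign
`(-1)^(i+1)` reads `(-1)^i`. -/
def dC (I : UniformIndexing D n) (k : ℕ) : Ct D n (k + 1) →+ Ct D n k where
  toFun x := fun l => ∑ μ : NTuple n (k + 1), ∑ i : Fin (k + 1), (-1 : ℤ) ^ (i : ℕ) •
    ((if l.1 = omit' μ.1 i then x μ else 0)
      - ((Equiv.Perm.sign (rho I μ.1 i) : ℤˣ) : ℤ) •
        (if l.1 = sharpOmit I μ.1 i ∘ rho I μ.1 i then opM I (μ.1 i) (x μ) else 0))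
  map_zero' := by
    funext l
    simp
  map_add' x y := by
    funext l
    simp only [Pi.add_apply, ← Finset.sum_add_distrib]
    refine Finset.sum_congr rfl fun μ _ => Finset.sum_congr rfl fun i _ => ?_
    rw [← smul_add]
    congr 1
    split_ifs <;> simp only [map_add, smul_add, smul_zero] <;> abel

/-- The sequence `a_0 = 0`, `a_k = a_{k-1} + k - 1`. -/
def aSeq : ℕ → ℕ
  | 0 => 0
  | k + 1 => aSeq k + k

/-- The map `f_k(⊕ x_μ) = ∑_μ ∑_σ (-1)^(m(σ) + a_k) x_μ(μ_{σ(1)} | ... | μ_{σ(k)})`, where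
`(-1)^m(σ)` is the sign of `σ`. For `k = 0` this is the identity of `ℤ[Γ \ E^×]`. -/
def fC (I : UniformIndexing D n) (k : ℕ) : Ct D n k →+ ZOrb (D.level k) where
  toFun x := ∑ μ : NTuple n k, ∑ σ : Equiv.Perm (Fin k),
    (((Equiv.Perm.sign σ : ℤˣ) : ℤ) * (-1 : ℤ) ^ aSeq k) •
      evalOrb I k (fun j => {μ.1 (σ j)}) (x μ)
  map_zero' := by simp
  map_add' x y := by
    simp only [Pi.add_apply, map_add, smul_add, Finset.sum_add_distrib]

end Ctilde

end IndRes

end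

/-! For `y = e(S)` and a member `T = {e(S ∪ {R})} ∪ (R · e(S))^×` of its covers, the element `e(S ∪
{R})` is orthogonal to every `f · e(S)` with `f ∈ R`, because `f (e - ⋁ R) = 0`. Hence the image of
`⋁ T` in `ℤ[E^×]` is `(e - ⋁ R) e(S) + (⋁ R) e(S) = e(S)`, and `y - ⋁ T` is sent to `0`. The
inclusion induces a ring homomorphism, so it kills all of `E_2`; this is `∂∂ = 0`
(`IsStable.incl_eq_zero`). The argument repeats at each level because a weak form of (i),
`IsStable`, passes from `E` to `E(E, 𝓡)`.

The same orthogonality, applied recursively, computes boundaries (`join_evalAux`,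
`bdryC_comp_evalOrb`): `∂ e(q_1|…|q_k|p)` is `e(q_1|…|q_k)`, minus the sum over `j` of the elements
with `q_j` replaced by `{p, q_j}`, minus `(M_p e)(p # q_1|…|p # q_k)`. In an alternating sum over
orderings the middle terms cancel, since exchanging `p` and `q_j` preserves `{p, q_j}` and reverses
the sign. What survives is the formula for `d`; the signs `(-1)^(a_k)` absorb the factor `(-1)^k`
that comes from removing the last entry instead of the first.

To avoid sorting tuples, `d` is studied through its transpose `codiff` on alternating families of
homomorphisms, where the sign of `ρ_{μ,i}` disappears (`pairing_dC`). Its square vanishes because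
removing two entries in either order gives the same term with opposite signs (`codiff_codiff`). This
needs `M_{i#j} M_i = M_{j#i} M_j`, where both sides send `[e]` to `[⋁ R_i(e) · ⋁ R_j(e)]`, and
`(i#j)#(i#l) = (j#i)#(j#l)`, which is read off at a product of maximal elements of `R_i(e)` and
`R_j(e)`. Condition (ii) enters through `sharp_ne`: `j ↦ i # j` is injective away from `i`. -/

noncomputable section

namespace IndRes

open scoped Classical

universe u v w

/-! ### Inclusion-exclusion calculus of joins -/

section Join

variable {E : Type u} [SemilatticeInf E] [OrderBot E]

theorem of_mul_self (a : E) : of a * of a = of a := by rw [of_mul_of, inf_idem]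

theorem join_empty : join (∅ : Finset E) = 0 := by simp [join]

/-- Subsets of `insert a A` split according to whether they contain `a`. This recursion makes the
later algebra of joins an induction with no sums over subsets. -/
theorem join_insert_of_notMem {a : E} {A : Finset E} (ha : a ∉ A) :
    join (insert a A) = of a + join A - of a * join A := by
  have key : ∀ J ∈ A.powerset,
      (if h : (insert a J).Nonempty then
        (-1 : ℤ) ^ ((insert a J).card + 1) • of ((insert a J).inf' h id) else 0)
      = (if J = ∅ then of a else 0) - of a *
        (if h : J.Nonempty then (-1 : ℤ) ^ (J.card + 1) • of (J.inf' h id) else 0) := by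
    intro J hJ
    have haJ : a ∉ J := fun h => ha (Finset.mem_powerset.1 hJ h)
    rw [dif_pos (Finset.insert_nonempty a J), Finset.card_insert_of_notMem haJ]
    by_cases h : J.Nonempty
    · rw [dif_pos h, if_neg h.ne_empty, mul_smul_comm, of_mul_of, Finset.inf'_insert h]
      simp [pow_succ]
    · rw [Finset.not_nonempty_iff_eq_empty] at h
      subst h
      simp
  unfold join
  rw [Finset.sum_powerset_insert ha, Finset.sum_congr rfl key, Finset.sum_sub_distrib,
    ← Finset.mul_sum, Finset.sum_ite_eq' A.powerset ∅ (fun _ => of a),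
    if_pos (Finset.empty_mem_powerset A)]
  abel

theorem of_mul_join_of_mem {a : E} {A : Finset E} (ha : a ∈ A) : of a * join A = of a := by
  rw [← Finset.insert_erase ha, join_insert_of_notMem (Finset.notMem_erase a A), mul_sub, mul_add,
    ← mul_assoc, of_mul_self]
  abel

theorem join_insert (a : E) (A : Finset E) :
    join (insert a A) = of a + join A - of a * join A := by
  by_cases ha : a ∈ A
  · rw [Finset.insert_eq_of_mem ha, of_mul_join_of_mem ha]
    abel
  · exact join_insert_of_notMem ha

theorem join_erase_bot (A : Finset E) : join (A.erase ⊥) = join A := by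
  by_cases h : ⊥ ∈ A
  · conv_rhs => rw [← Finset.insert_erase h, join_insert, of_bot]
    simp
  · rw [Finset.erase_eq_of_notMem h]

/-- Multiplying a cover may produce `⊥`, so covers are compared only after erasing it; joins do not
see the difference. -/
theorem join_congr {A B : Finset E} (h : A.erase ⊥ = B.erase ⊥) : join A = join B := by
  rw [← join_erase_bot, h, join_erase_bot]

/-- A multiplicative map sends joins to joins. -/
theorem map_join {F : Type w} [SemilatticeInf F] [OrderBot F] (Φ : Zx E →+ Zx F) (φ : E → F)
    (hΦ : ∀ a, Φ (of a) = of (φ a)) (hmul : ∀ a z, Φ (of a * z) = of (φ a) * Φ z)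
    (A : Finset E) : Φ (join A) = join (A.image φ) := by
  induction A using Finset.induction_on with
  | empty => simp [join_empty]
  | insert a A _ ih =>
    rw [join_insert, Finset.image_insert, join_insert, map_sub, map_add, hΦ, hmul, ih]

theorem of_mul_join (d : E) (A : Finset E) : of d * join A = join (mulCover d A) := by
  rw [mulCover, join_erase_bot]
  refine map_join (mulHom (of d)) (fun f => d ⊓ f) (fun a => of_mul_of d a) (fun a z => ?_) A
  rw [← mul_def, ← mul_def, ← of_mul_of, mul_mul_mul_comm, of_mul_self]

theorem mulCover_of_le {x : E} {A : Finset E} (h : ∀ f ∈ A, f ≤ x) :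
    mulCover x A = A.erase ⊥ := by
  unfold mulCover
  congr 1
  conv_rhs => rw [← Finset.image_id (s := A)]
  exact Finset.image_congr fun f hf => inf_eq_right.2 (h f hf)

theorem of_mul_join_of_le {x : E} {A : Finset E} (h : ∀ f ∈ A, f ≤ x) :
    of x * join A = join A := by
  rw [of_mul_join, mulCover_of_le h, join_erase_bot]

theorem mem_mulCover {d g : E} {A : Finset E} :
    g ∈ mulCover d A ↔ g ≠ ⊥ ∧ ∃ f ∈ A, d ⊓ f = g := by
  simp [mulCover]

theorem mulCover_le {d x : E} {A : Finset E} (h : ∀ f ∈ A, f ≤ x) :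
    ∀ f ∈ mulCover d A, f ≤ d ⊓ x := by
  intro f hf
  obtain ⟨_, g, hg, rfl⟩ := mem_mulCover.1 hf
  exact inf_le_inf_left d (h g hg)

theorem mulCover_mulCover (d e : E) (A : Finset E) :
    mulCover d (mulCover e A) = mulCover (d ⊓ e) A := by
  ext g
  simp only [mem_mulCover]
  constructor
  · rintro ⟨hg, f, ⟨_, a, ha, rfl⟩, rfl⟩
    exact ⟨hg, a, ha, inf_assoc _ _ _⟩
  · rintro ⟨hg, a, ha, rfl⟩
    refine ⟨hg, e ⊓ a, ⟨fun h => hg ?_, a, ha, rfl⟩, (inf_assoc _ _ _).symm⟩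
    rw [inf_assoc, h, inf_bot_eq]

theorem mulCover_erase_bot (d : E) (A : Finset E) : mulCover d (A.erase ⊥) = mulCover d A := by
  ext g
  simp only [mem_mulCover, Finset.mem_erase]
  constructor
  · rintro ⟨hg, f, ⟨_, hf⟩, rfl⟩
    exact ⟨hg, f, hf, rfl⟩
  · rintro ⟨hg, f, hf, rfl⟩
    exact ⟨hg, f, ⟨fun h => hg (by rw [h, inf_bot_eq]), hf⟩, rfl⟩

theorem mulCover_congr (d : E) {A B : Finset E} (h : A.erase ⊥ = B.erase ⊥) :
    mulCover d A = mulCover d B := by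
  rw [← mulCover_erase_bot, h, mulCover_erase_bot]

theorem erase_bot_mulCover (d : E) (A : Finset E) : (mulCover d A).erase ⊥ = mulCover d A := by
  simp [mulCover]

theorem join_mul_self (A : Finset E) : join A * join A = join A := by
  induction A using Finset.induction_on with
  | empty => simp [join_empty]
  | insert a A _ ih =>
    have h1 : of a * (of a + join A - of a * join A) = of a := by
      rw [mul_sub, mul_add, ← mul_assoc, of_mul_self]; abel
    have h2 : join A * (of a + join A - of a * join A) = join A := by
      rw [mul_sub, mul_add, ih, mul_left_comm, ih, mul_comm (join A)]; abel
    rw [join_insert, sub_mul, add_mul, mul_assoc, h2, h1]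

theorem of_sub_join_mul_self {x : E} {A : Finset E} (h : ∀ f ∈ A, f ≤ x) :
    (of x - join A) * (of x - join A) = of x - join A := by
  rw [sub_mul, mul_sub, mul_sub, of_mul_self, join_mul_self, mul_comm (join A),
    of_mul_join_of_le h]
  abel

theorem of_mul_of_sub_join {x : E} {A : Finset E} (h : ∀ f ∈ A, f ≤ x) :
    of x * (of x - join A) = of x - join A := by
  rw [mul_sub, of_mul_self, of_mul_join_of_le h]

theorem of_mul_of_sub_join_of_mem {x f : E} {A : Finset E} (h : ∀ f ∈ A, f ≤ x) (hf : f ∈ A) :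
    of f * (of x - join A) = 0 := by
  rw [mul_sub, of_mul_of, inf_eq_left.2 (h f hf), of_mul_join_of_mem hf, sub_self]

end Join

/-! ### Products of complements of joins -/

section Cut

variable {E : Type u} [SemilatticeInf E] [OrderBot E] {ι : Type w}

theorem cut_empty (e : E) (c : ι → Finset E) : cut e c ∅ = of e := rfl

theorem cut_insert_of_notMem [DecidableEq ι] (e : E) (c : ι → Finset E) {s : Finset ι} {i : ι}
    (hi : i ∉ s) :
    cut e c (insert i s) = (of e - join (c i)) * cut e c s :=
  Finset.fold_insert hi

/-- No condition `i ∉ s` is needed, as a repeated factor is idempotent. -/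
theorem cut_insert [DecidableEq ι] {e : E} {c : ι → Finset E} {i : ι} (h : ∀ f ∈ c i, f ≤ e)
    (s : Finset ι) :
    cut e c (insert i s) = (of e - join (c i)) * cut e c s := by
  by_cases hi : i ∈ s
  · rw [Finset.insert_eq_of_mem hi, ← Finset.insert_erase hi,
      cut_insert_of_notMem _ _ (Finset.notMem_erase i s), ← mul_assoc, of_sub_join_mul_self h]
  · exact cut_insert_of_notMem e c hi

theorem cut_singleton {e : E} {c : ι → Finset E} {i : ι} (h : ∀ f ∈ c i, f ≤ e) :
    cut e c {i} = of e - join (c i) := by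
  rw [← insert_empty_eq, cut_insert h, cut_empty, mul_comm, of_mul_of_sub_join h]

theorem cut_congr {e : E} {c c' : ι → Finset E} {s : Finset ι}
    (h : ∀ i ∈ s, (c i).erase ⊥ = (c' i).erase ⊥) : cut e c s = cut e c' s :=
  Finset.fold_congr fun i hi => by rw [join_congr (h i hi)]

theorem of_mul_cut (d e : E) (c : ι → Finset E) (s : Finset ι) :
    of d * cut e c s = cut (d ⊓ e) (fun i => mulCover d (c i)) s := by
  induction s using Finset.induction_on with
  | empty => rw [cut_empty, cut_empty, of_mul_of]
  | insert i s hi ih =>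
    rw [cut_insert_of_notMem _ _ hi, cut_insert_of_notMem _ _ hi, ← ih, ← of_mul_of,
      ← of_mul_join, ← mul_sub, mul_mul_mul_comm, of_mul_self]

theorem of_mul_cut_self (e : E) (c : ι → Finset E) (s : Finset ι) :
    of e * cut e c s = cut e c s := by
  induction s using Finset.induction_on with
  | empty => rw [cut_empty, of_mul_self]
  | insert i s hi ih => rw [cut_insert_of_notMem _ _ hi, mul_left_comm, ih]

theorem cut_mul_self {e : E} {c : ι → Finset E} {s : Finset ι} (h : ∀ i ∈ s, ∀ f ∈ c i, f ≤ e) :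
    cut e c s * cut e c s = cut e c s := by
  induction s using Finset.induction_on with
  | empty => rw [cut_empty, of_mul_self]
  | insert i s hi ih =>
    rw [cut_insert_of_notMem _ _ hi, mul_mul_mul_comm,
      of_sub_join_mul_self (h i (Finset.mem_insert_self i s)),
      ih fun j hj => h j (Finset.mem_insert_of_mem hj)]

/-- `π` may identify indices: repeated factors collapse by idempotency. -/
theorem cut_image {κ : Type*} [DecidableEq κ] {e : E} {c : κ → Finset E} (π : ι → κ) {s : Finset ι}
    (h : ∀ i ∈ s, ∀ f ∈ c (π i), f ≤ e) :
    cut e c (s.image π) = cut e (fun i => c (π i)) s := by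
  induction s using Finset.induction_on with
  | empty => rfl
  | insert i s hi ih =>
    rw [Finset.image_insert, cut_insert (h i (Finset.mem_insert_self i s)),
      cut_insert_of_notMem _ _ hi, ih fun j hj => h j (Finset.mem_insert_of_mem hj)]

theorem cut_eq_zero_of_mem {e : E} {c : ι → Finset E} {s : Finset ι} {i : ι} (hi : i ∈ s)
    (h : ∀ f ∈ c i, f ≤ e) (he : e ∈ c i) : cut e c s = 0 := by
  rw [← Finset.insert_eq_of_mem hi, cut_insert h, ← of_mul_of_sub_join h,
    of_mul_of_sub_join_of_mem h he, zero_mul]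

theorem mem_cutCover [DecidableEq ι] {e : E} {c : ι → Finset E} {s : Finset ι} {i : ι} {z : Zx E} :
    z ∈ cutCover e c s i ↔
      z = cut e c (insert i s) ∨ z ≠ 0 ∧ ∃ f ∈ c i, of f * cut e c s = z := by
  simp [cutCover]

end Cut

/-! ### Stability of the covers under multiplication, at every level -/

section Admissible

variable {E : Type u} [SemilatticeInf E] [OrderBot E]

/-- Up to `⊥`, the finite set `A` of elements below `x` is a member of the collection `cover x`, or
the difference `x - ⋁ A` vanishes for an obvious reason. -/
structure Admissible (cover : E → Set (Finset E)) (x : E) (A : Finset E) : Prop where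
  le : ∀ f ∈ A, f ≤ x
  cases : x = ⊥ ∨ x ∈ A ∨ ∃ R ∈ cover x, R.erase ⊥ = A.erase ⊥

theorem Admissible.congr {cover : E → Set (Finset E)} {x : E} {A B : Finset E}
    (h : Admissible cover x A) (hAB : A.erase ⊥ = B.erase ⊥) : Admissible cover x B where
  le f hf := by
    by_cases h0 : f = ⊥
    · rw [h0]; exact bot_le
    · have : f ∈ A.erase ⊥ := hAB ▸ Finset.mem_erase.2 ⟨h0, hf⟩
      exact h.le f (Finset.mem_of_mem_erase this)
  cases := by
    rcases h.cases with h1 | h1 | ⟨R, hR, h1⟩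
    · exact Or.inl h1
    · by_cases h0 : x = ⊥
      · exact Or.inl h0
      · have : x ∈ B.erase ⊥ := hAB ▸ Finset.mem_erase.2 ⟨h0, h1⟩
        exact Or.inr (Or.inl (Finset.mem_of_mem_erase this))
    · exact Or.inr (Or.inr ⟨R, hR, h1.trans hAB⟩)

end Admissible

section Stable

variable {Γ : Type v} [Group Γ] {D : CoverData.{u} Γ}

/-- The members of `𝓡(e)` lie below `e`, and admissible sets are stable under multiplication: this
is the part of the conditions on the covers that carries over from `E` to `E(E, 𝓡)` on its own. -/
structure IsStable (D : CoverData.{u} Γ) : Prop where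
  le : ∀ e : D.E, e ≠ ⊥ → ∀ R ∈ D.cover e, ∀ f ∈ R, f ≤ e
  mul : ∀ (d x : D.E) (A : Finset D.E), Admissible D.cover x A →
    Admissible D.cover (d ⊓ x) (mulCover d A)

theorem IsCoverSystem.isStable (hD : IsCoverSystem D) : IsStable D where
  le e he R hR f hf := ((hD.finite_cover e he R hR).1 f hf).2
  mul d x A h := by
    refine ⟨mulCover_le h.le, ?_⟩
    by_cases h0 : d ⊓ x = ⊥
    · exact Or.inl h0
    refine Or.inr ?_
    rcases h.cases with h1 | h1 | ⟨R, hR, h1⟩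
    · exact absurd (by rw [h1, inf_bot_eq]) h0
    · exact Or.inl (mem_mulCover.2 ⟨h0, x, h1, rfl⟩)
    · rw [← mulCover_congr d h1]
      rcases hD.cond_i d x h0 R hR with h2 | h2
      · exact Or.inl h2
      · exact Or.inr ⟨_, h2, rfl⟩

theorem IsStable.admissible_cover (hD : IsStable D) {e : D.E} (he : e ≠ ⊥) {R : Finset D.E}
    (hR : R ∈ D.cover e) : Admissible D.cover e R :=
  ⟨hD.le e he R hR, Or.inr (Or.inr ⟨R, hR, rfl⟩)⟩

theorem Admissible.of_sub_join_mem_gens {x : D.E} {A : Finset D.E}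
    (h : Admissible D.cover x A) : of x - join A ∈ gens D := by
  by_cases h0 : x = ⊥
  · left
    rw [← of_mul_join_of_le h.le, h0, of_bot, zero_mul, sub_zero]
  rcases h.cases with h1 | h1 | ⟨R, hR, h1⟩
  · exact absurd h1 h0
  · left
    rw [← of_mul_join_of_le h.le, of_mul_join_of_mem h1, sub_self]
  · exact Or.inr ⟨x, h0, R, hR, by rw [join_congr h1]⟩

theorem IsStable.of_mul_mem_gens (hD : IsStable D) (d : D.E) {z : Zx D.E} (hz : z ∈ gens D) :
    of d * z ∈ gens D := by
  rcases hz with rfl | ⟨e, he, R, hR, rfl⟩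
  · rw [mul_zero]; exact Or.inl rfl
  · rw [mul_sub, of_mul_of, of_mul_join]
    exact (hD.mul d e R (hD.admissible_cover he hR)).of_sub_join_mem_gens

theorem IsStable.mul_self_of_mem_closure (hD : IsStable D) {z : Zx D.E}
    (hz : z ∈ Subsemigroup.closure (gens D)) : z * z = z := by
  induction hz using Subsemigroup.closure_induction with
  | mem y hy =>
    rcases hy with rfl | ⟨e, he, R, hR, rfl⟩
    · rw [mul_zero]
    · exact of_sub_join_mul_self (hD.le e he R hR)
  | mul a b _ _ ha hb => rw [mul_mul_mul_comm, ha, hb]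

/-- The generators are commuting idempotents, so the idempotency clause in `nextSet` is automatic.
-/
theorem IsStable.mem_nextSet (hD : IsStable D) {z : Zx D.E} :
    z ∈ nextSet D ↔ z ∈ Subsemigroup.closure (gens D) :=
  ⟨fun h => h.2, fun h => ⟨hD.mul_self_of_mem_closure h, h⟩⟩

theorem IsStable.of_mul_mem_nextSet (hD : IsStable D) (d : D.E) {z : Zx D.E}
    (hz : z ∈ nextSet D) : of d * z ∈ nextSet D := by
  rw [hD.mem_nextSet] at hz ⊢
  induction hz using Subsemigroup.closure_induction with
  | mem y hy => exact Subsemigroup.subset_closure (hD.of_mul_mem_gens d hy)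
  | mul a b _ _ ha hb =>
    rw [← of_mul_self, mul_mul_mul_comm]
    exact Subsemigroup.mul_mem _ ha hb

theorem IsStable.cut_mem_nextSet (hD : IsStable D) {ι : Type w} [DecidableEq ι] {x : D.E} {c : ι → Finset D.E}
    {s : Finset ι} (hs : s.Nonempty) (h : ∀ i ∈ s, Admissible D.cover x (c i)) :
    cut x c s ∈ nextSet D := by
  rw [hD.mem_nextSet]
  induction hs using Finset.Nonempty.cons_induction with
  | singleton i =>
    rw [cut_singleton (h i (Finset.mem_singleton_self i)).le]
    exact Subsemigroup.subset_closure
      (h i (Finset.mem_singleton_self i)).of_sub_join_mem_gens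
  | cons i s hi hs ih =>
    rw [Finset.cons_eq_insert, cut_insert_of_notMem _ _ hi]
    refine Subsemigroup.mul_mem _ (Subsemigroup.subset_closure ?_)
      (ih fun j hj => h j (Finset.mem_cons_of_mem hj))
    exact (h i (Finset.mem_cons_self i s)).of_sub_join_mem_gens

theorem IsStable.cutCover_subset_nextSet (hD : IsStable D) {ι : Type w} [DecidableEq ι] {x : D.E}
    {c : ι → Finset D.E} {s : Finset ι} (hs : s.Nonempty) {i : ι}
    (h : ∀ j ∈ insert i s, Admissible D.cover x (c j)) {z : Zx D.E} (hz : z ∈ cutCover x c s i) :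
    z ∈ nextSet D := by
  rcases mem_cutCover.1 hz with rfl | ⟨_, f, _, rfl⟩
  · exact hD.cut_mem_nextSet (Finset.insert_nonempty i s) h
  · exact hD.of_mul_mem_nextSet f
      (hD.cut_mem_nextSet hs fun j hj => h j (Finset.mem_insert_of_mem hj))

theorem toNext_val {z : Zx D.E} (hz : z ∈ nextSet D) : (toNext D z).val = z := by
  rw [toNext, dif_pos hz]

theorem toNext_coe (y : Next D) : toNext D y.val = y := by
  rw [toNext, dif_pos y.property]

theorem Next.le_iff {x y : Next D} : x ≤ y ↔ x.val * y.val = x.val := by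
  rw [← inf_eq_left, Next.ext_iff, Next.coe_inf]

theorem Next.eq_bot_iff {x : Next D} : x = ⊥ ↔ x.val = 0 := by
  rw [Next.ext_iff, Next.coe_bot]

theorem cutCover_congr {E : Type u} [SemilatticeInf E] [OrderBot E] {ι : Type w} [DecidableEq ι] {x : E}
    {c c' : ι → Finset E} {s : Finset ι} {i : ι}
    (h : ∀ j ∈ insert i s, (c j).erase ⊥ = (c' j).erase ⊥) :
    cutCover x c s i = cutCover x c' s i := by
  have aux : ∀ (c c' : ι → Finset E), (c i).erase ⊥ = (c' i).erase ⊥ →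
      ∀ y z : Zx E, (z ≠ 0 ∧ ∃ f ∈ c i, of f * y = z) → ∃ f ∈ c' i, of f * y = z := by
    rintro c c' hc y z ⟨hz, f, hf, rfl⟩
    have : f ∈ (c i).erase ⊥ :=
      Finset.mem_erase.2 ⟨fun h0 => hz (by rw [h0, of_bot, zero_mul]), hf⟩
    rw [hc] at this
    exact ⟨f, Finset.mem_of_mem_erase this, rfl⟩
  have hi := h i (Finset.mem_insert_self i s)
  ext z
  rw [mem_cutCover, mem_cutCover, cut_congr h,
    cut_congr fun j hj => h j (Finset.mem_insert_of_mem hj)]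
  exact or_congr_right ⟨fun hz => ⟨hz.1, aux c c' hi _ z hz⟩,
    fun hz => ⟨hz.1, aux c' c hi.symm _ z hz⟩⟩

/-- The sets `c j` are only admissible, and different indices may carry the same set. Each
degeneration makes the product vanish or puts it into its own cover; otherwise a genuine member of
`nextCover` results. -/
theorem IsStable.admissible_cutCover (hD : IsStable D) {ι : Type w} [DecidableEq ι] {x : D.E}
    {c : ι → Finset D.E} {s : Finset ι} (hs : s.Nonempty) {i : ι}
    (h : ∀ j ∈ insert i s, Admissible D.cover x (c j)) :
    Admissible (nextCover D) (toNext D (cut x c s)) (toNextSet D (cutCover x c s i)) := by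
  have hle : ∀ j ∈ insert i s, ∀ f ∈ c j, f ≤ x := fun j hj => (h j hj).le
  have hle' : ∀ j ∈ s, ∀ f ∈ c j, f ≤ x := fun j hj => hle j (Finset.mem_insert_of_mem hj)
  have hmem : cut x c s ∈ nextSet D :=
    hD.cut_mem_nextSet hs fun j hj => h j (Finset.mem_insert_of_mem hj)
  have hval := toNext_val hmem
  refine ⟨fun y hy => ?_, ?_⟩
  · rw [Next.le_iff, hval]
    rcases mem_cutCover.1 (mem_toNextSet D |>.1 hy) with h1 | ⟨_, f, _, h1⟩
    · rw [h1, cut_insert (hle i (Finset.mem_insert_self i s)), mul_assoc, cut_mul_self hle']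
    · rw [← h1, mul_assoc, cut_mul_self hle']
  by_cases h0 : cut x c s = 0
  · left
    rw [Next.eq_bot_iff, hval, h0]
  right
  have hx : x ≠ ⊥ := fun hx => h0 (by rw [← of_mul_cut_self, hx, of_bot, zero_mul])
  by_cases hxi : x ∈ c i
  · left
    rw [mem_toNextSet, hval, mem_cutCover]
    exact Or.inr ⟨h0, x, hxi, of_mul_cut_self x c s⟩
  have hR : ∀ j ∈ insert i s, ∃ R ∈ D.cover x, R.erase ⊥ = (c j).erase ⊥ := by
    intro j hj
    rcases (h j hj).cases with h1 | h1 | h1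
    · exact absurd h1 hx
    · rcases Finset.mem_insert.1 hj with rfl | hj'
      · exact absurd h1 hxi
      · exact absurd (cut_eq_zero_of_mem hj' (hle j hj) h1) h0
    · exact h1
  choose! R hRc hRe using hR
  have hRle : ∀ j ∈ insert i s, ∀ f ∈ R j, f ≤ x := fun j hj => hD.le x hx _ (hRc j hj)
  have hcut : ∀ t : Finset ι, t ⊆ insert i s → cut x c t = cut x id (t.image R) := by
    intro t ht
    rw [cut_image (c := id) R fun j hj => hRle j (ht hj)]
    exact cut_congr fun j hj => (hRe j (ht hj)).symm
  have hcs := hcut s (Finset.subset_insert i s)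
  -- If the cover for `i` already occurs among those for `s`, the extra factor changes nothing, so
  -- the cut element is its own first cover member.
  by_cases hiS : R i ∈ s.image R
  · left
    rw [mem_toNextSet, hval, mem_cutCover]
    left
    rw [hcs, hcut _ subset_rfl, Finset.image_insert, Finset.insert_eq_of_mem hiS]
  · right
    refine ⟨_, ⟨x, hx, s.image R, hs.image R, ?_, ?_, R i, hRc i (Finset.mem_insert_self i s), hiS,
      rfl⟩, ?_⟩
    · intro Q hQ
      obtain ⟨j, hj, rfl⟩ := Finset.mem_image.1 hQ
      exact hRc j (Finset.mem_insert_of_mem hj)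
    · rw [hval, hcs]
    · congr 2
      have : cutCover x c s i = cutCover x R s i := cutCover_congr fun j hj => (hRe j hj).symm
      rw [this]
      ext z
      rw [mem_cutCover, mem_cutCover, ← Finset.image_insert, ← hcs, ← hcut _ subset_rfl,
        cut_congr hRe,
        cut_congr fun j hj => hRe j (Finset.mem_insert_of_mem hj)]
      rfl

/-- Stability under multiplication is inherited by `E(E, 𝓡)`. -/
theorem IsStable.admissible_next_mul (hD : IsStable D) {x : Next D} {A : Finset (Next D)}
    (h : Admissible (nextCover D) x A) (y : Next D) :
    Admissible (nextCover D) (y ⊓ x) (mulCover y A) := by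
  obtain ⟨y, hy⟩ := y
  have hy' := (hD.mem_nextSet).1 hy
  induction hy' using Subsemigroup.closure_induction generalizing x A with
  | mul a b ha hb iha ihb =>
    have ha' := (hD.mem_nextSet).2 ha
    have hb' := (hD.mem_nextSet).2 hb
    have e : (⟨a * b, hy⟩ : Next D) = ⟨a, ha'⟩ ⊓ ⟨b, hb'⟩ := rfl
    rw [e, inf_assoc, ← mulCover_mulCover]
    exact iha (ihb h hb') ha'
  | mem z hz =>
    refine ⟨mulCover_le h.le, ?_⟩
    by_cases h0 : (⟨z, hy⟩ : Next D) ⊓ x = ⊥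
    · exact Or.inl h0
    have h0' : z * x.val ≠ 0 := fun hzx => h0 (Next.eq_bot_iff.2 hzx)
    rcases hz with rfl | ⟨d, hd, R₀, hR₀, rfl⟩
    · exact absurd (zero_mul _) h0'
    rcases h.cases with h1 | h1 | ⟨T, ⟨e, he, S, hS, hSc, hx, R, hR, -, rfl⟩, h1⟩
    · exact absurd (by rw [h1, inf_bot_eq]) h0
    · exact Or.inr (Or.inl (mem_mulCover.2 ⟨h0, x, h1, rfl⟩))
    -- The product `(d - ⋁ R₀) · e(S)` is a cut of `d ⊓ e` by `(e R₀)^×` and the `(d Q)^×`, `Q ∈ S`.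
    -- The index type `Option` keeps these factors apart even when the sets coincide.
    let c : Option (Finset D.E) → Finset D.E := fun o => o.elim (mulCover e R₀) (mulCover d)
    let s : Finset (Option (Finset D.E)) := insert none (S.image some)
    have hc : ∀ Q : Finset D.E, Q ∈ D.cover e → Admissible D.cover (d ⊓ e) (c (some Q)) :=
      fun Q hQ => hD.mul d e Q (hD.admissible_cover he hQ)
    have hc0 : Admissible D.cover (d ⊓ e) (c none) := by
      rw [inf_comm]
      exact hD.mul e d R₀ (hD.admissible_cover hd hR₀)
    have hcs : ∀ j ∈ insert (some R) s, Admissible D.cover (d ⊓ e) (c j) := by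
      intro j hj
      simp only [s, Finset.mem_insert, Finset.mem_image] at hj
      rcases hj with rfl | rfl | ⟨Q, hQ, rfl⟩
      · exact hc R hR
      · exact hc0
      · exact hc Q (hSc Q hQ)
    have key : ∀ S' : Finset (Finset D.E), (∀ Q ∈ S', Q ∈ D.cover e) →
        cut (d ⊓ e) c (insert none (S'.image some)) = (of d - join R₀) * cut e id S' := by
      intro S' hS'
      rw [cut_insert hc0.le]
      have h2 : cut (d ⊓ e) c (S'.image some) = of d * cut e id S' := by
        rw [cut_image (c := c) some fun Q hQ => (hc Q (hS' Q hQ)).le, of_mul_cut]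
        rfl
      have h3 : of (d ⊓ e) - join (c none) = of e * (of d - join R₀) := by
        rw [mul_sub, of_mul_of, of_mul_join, inf_comm]
        rfl
      rw [h2, h3, mul_comm (of e), mul_mul_mul_comm, of_mul_cut_self, mul_comm _ (of d),
        of_mul_of_sub_join (hD.le d hd R₀ hR₀)]
    have hs : s.Nonempty := Finset.insert_nonempty _ _
    have main := hD.admissible_cutCover hs hcs
    have hins : insert (some R) s = insert none ((insert R S).image some) := by
      rw [Finset.image_insert]
      exact Finset.insert_comm _ _ _
    have hcut : cut (d ⊓ e) c s = (of d - join R₀) * cut e id S := key S hSc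
    have hcut' : cut (d ⊓ e) c (insert (some R) s) = (of d - join R₀) * cut e id (insert R S) := by
      rw [hins]
      refine key _ fun Q hQ => ?_
      rcases Finset.mem_insert.1 hQ with rfl | hQ
      · exact hR
      · exact hSc Q hQ
    have hx' : toNext D (cut (d ⊓ e) c s) = (⟨of d - join R₀, hy⟩ : Next D) ⊓ x := by
      rw [hcut, ← hx]
      exact toNext_coe (⟨of d - join R₀, hy⟩ ⊓ x)
    rw [hx'] at main
    have hS' : ∀ j ∈ insert R S, Admissible D.cover e (id j) := by
      intro j hj
      rcases Finset.mem_insert.1 hj with rfl | hj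
      · exact hD.admissible_cover he hR
      · exact hD.admissible_cover he (hSc j hj)
    refine (main.congr ?_).cases
    rw [erase_bot_mulCover, ← mulCover_congr _ h1]
    ext y
    rw [Finset.mem_erase, mem_toNextSet, mem_mulCover]
    refine and_congr_right fun hy0 => ?_
    have hy0' : y.val ≠ 0 := fun h => hy0 (Next.eq_bot_iff.2 h)
    have e1 : (of d - join R₀) * (of d - join R₀) = of d - join R₀ :=
      of_sub_join_mul_self (hD.le d hd R₀ hR₀)
    -- The factor `d - ⋁ R₀` absorbs `d`, which matches multiples by `f` with multiples by `d ⊓ f`.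
    have e2 := of_mul_of_sub_join (hD.le d hd R₀ hR₀)
    rw [mem_cutCover, hcut, hcut']
    constructor
    · rintro (h2 | ⟨-, f, hf, h2⟩)
      · refine ⟨⟨_, hD.cutCover_subset_nextSet hS hS' (mem_cutCover.2 (Or.inl rfl))⟩, ?_, ?_⟩
        · exact mem_toNextSet D |>.2 (mem_cutCover.2 (Or.inl rfl))
        · exact Next.ext h2.symm
      · obtain ⟨-, f', hf', rfl⟩ := mem_mulCover.1 hf
        have h3 : (of d - join R₀) * (of f' * cut e id S) = y.val := by
          rw [← h2, ← of_mul_of, mul_mul_mul_comm, e2]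
        have hz0 : of f' * cut e id S ≠ 0 := fun h4 => hy0' (by rw [← h3, h4, mul_zero])
        have hz : of f' * cut e id S ∈ cutCover e id S R :=
          mem_cutCover.2 (Or.inr ⟨hz0, f', hf', rfl⟩)
        exact ⟨⟨_, hD.cutCover_subset_nextSet hS hS' hz⟩, mem_toNextSet D |>.2 hz, Next.ext h3⟩
    · rintro ⟨z, hz, rfl⟩
      rcases mem_cutCover.1 (mem_toNextSet D |>.1 hz) with h2 | ⟨-, f, hf, h2⟩
      · left
        rw [← h2]; rfl
      · right
        have h3 : (of d - join R₀) * (of f * cut e id S) =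
            of (d ⊓ f) * ((of d - join R₀) * cut e id S) := by
          rw [← of_mul_of, mul_mul_mul_comm, e2]
        refine ⟨hy0', d ⊓ f, mem_mulCover.2 ⟨fun h4 => hy0' ?_, f, hf, rfl⟩, ?_⟩
        · rw [Next.coe_inf, ← h2, h3, h4, of_bot, zero_mul]
        · rw [Next.coe_inf, ← h2, h3]

theorem IsStable.le_of_mem_nextCover (hD : IsStable D) {x : Next D} {T : Finset (Next D)}
    (hT : T ∈ nextCover D x) : ∀ f ∈ T, f ≤ x := by
  obtain ⟨e, he, S, hS, hSc, hx, R, hR, -, rfl⟩ := hT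
  have hS' : ∀ j ∈ insert R S, Admissible D.cover e (id j) := by
    intro j hj
    rcases Finset.mem_insert.1 hj with rfl | hj
    · exact hD.admissible_cover he hR
    · exact hD.admissible_cover he (hSc j hj)
  have := (hD.admissible_cutCover hS hS').le
  rwa [← hx, toNext_coe] at this

theorem IsStable.next (hD : IsStable D) : IsStable D.next where
  le _ _ _ hT := hD.le_of_mem_nextCover hT
  mul d _ _ h := hD.admissible_next_mul h d

theorem IsStable.level (hD : IsStable D) (k : ℕ) : IsStable (D.level k) := by
  induction k with
  | zero => exact hD
  | succ k ih => exact ih.next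

end Stable

/-! ### The ring homomorphism induced by the inclusion, and `∂∂ = 0` -/

section Incl

variable {Γ : Type v} [Group Γ] {D : CoverData.{u} Γ}

/-- The ring homomorphism `ℤ[E(E, 𝓡)^×] → ℤ[E^×]` induced by the inclusion. -/
def incl (D : CoverData.{u} Γ) : Zx (Next D) →+ Zx D.E := lift fun y => y.1.val

theorem incl_of (y : Next D) : incl D (of y) = y.val := by
  by_cases h : y = ⊥
  · subst h
    rw [of_bot, map_zero]
    rfl
  · exact lift_of (fun y : Pos (Next D) => y.1.val) ⟨y, h⟩

theorem incl_mul (a b : Zx (Next D)) : incl D (a * b) = incl D a * incl D b := by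
  have key : ∀ (x : Pos (Next D)) (b : Zx (Next D)),
      incl D (of (x : Next D) * b) = incl D (of (x : Next D)) * incl D b := by
    intro x b
    have : (incl D).comp (mulHom (of (x : Next D)))
        = (mulHom (incl D (of (x : Next D)))).comp (incl D) := by
      apply addHom_ext; intro y
      simp only [AddMonoidHom.comp_apply, ← mul_def, of_mul_of, incl_of, Next.coe_inf]
    exact DFunLike.congr_fun this b
  have : (incl D).comp ((mulHom : Zx (Next D) →+ Zx (Next D) →+ Zx (Next D)).flip b)
      = ((mulHom : Zx D.E →+ Zx D.E →+ Zx D.E).flip (incl D b)).comp (incl D) := by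
    apply addHom_ext; intro x
    simpa [mul_def] using key x b
  exact DFunLike.congr_fun this a

/-- The homomorphism `ℤ[E^×] → ℤ[E(E, 𝓡)^×]`, `f ↦ f y`, for `y ∈ E(E, 𝓡)`. -/
def mulNext (D : CoverData.{u} Γ) (y : Next D) : Zx D.E →+ Zx (Next D) :=
  lift fun f => of (toNext D (of (f : D.E) * y.val))

theorem mulNext_of (y : Next D) (f : D.E) :
    mulNext D y (of f) = of (toNext D (of f * y.val)) := by
  by_cases h : f = ⊥
  · subst h
    have : toNext D (of ⊥ * y.val) = ⊥ := by
      rw [of_bot, zero_mul]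
      exact toNext_coe ⊥
    rw [this, of_bot, of_bot, map_zero]
  · exact lift_of (fun f : Pos D.E => of (toNext D (of (f : D.E) * y.val))) ⟨f, h⟩

theorem IsStable.toNext_mul_val (hD : IsStable D) (y : Next D) (f : D.E) :
    (toNext D (of f * y.val)).val = of f * y.val :=
  toNext_val (hD.of_mul_mem_nextSet f y.property)

theorem IsStable.mulNext_mul (hD : IsStable D) (y : Next D) (f : D.E) (z : Zx D.E) :
    mulNext D y (of f * z) = of (toNext D (of f * y.val)) * mulNext D y z := by
  have : (mulNext D y).comp (mulHom (of f))
      = (mulHom (of (toNext D (of f * y.val)))).comp (mulNext D y) := by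
    apply addHom_ext; intro g
    simp only [AddMonoidHom.comp_apply, ← mul_def, of_mul_of, mulNext_of]
    congr 1
    apply Next.ext
    rw [Next.coe_inf, hD.toNext_mul_val, hD.toNext_mul_val, hD.toNext_mul_val,
      mul_mul_mul_comm, y.property.1, of_mul_of]
  exact DFunLike.congr_fun this z

theorem IsStable.mulNext_join (hD : IsStable D) (y : Next D) (A : Finset D.E) :
    mulNext D y (join A) = join (A.image fun f => toNext D (of f * y.val)) :=
  map_join (mulNext D y) _ (mulNext_of y) (hD.mulNext_mul y) A

theorem IsStable.incl_mulNext (hD : IsStable D) (y : Next D) (z : Zx D.E) :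
    incl D (mulNext D y z) = z * y.val := by
  have : (incl D).comp (mulNext D y)
      = (mulHom : Zx D.E →+ Zx D.E →+ Zx D.E).flip y.val := by
    apply addHom_ext; intro g
    simp only [AddMonoidHom.comp_apply, mulNext_of, incl_of, hD.toNext_mul_val,
      AddMonoidHom.flip_apply, ← mul_def]
  exact DFunLike.congr_fun this z

theorem of_mul_join_eq_zero {E : Type u} [SemilatticeInf E] [OrderBot E] {a : E} {A : Finset E}
    (h : ∀ f ∈ A, a ⊓ f = ⊥) : of a * join A = 0 := by
  have : mulCover a A = ∅ := by
    refine Finset.eq_empty_iff_forall_notMem.2 fun g hg => ?_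
    obtain ⟨h0, f, hf, rfl⟩ := mem_mulCover.1 hg
    exact h0 (h f hf)
  rw [of_mul_join, this, join_empty]

/-- The new element `∏_{j ∈ s ∪ {i}} (x - ⋁ c_j)` is orthogonal to all multiples of elements of `c
i`, as it contains the factor `x - ⋁ c_i`. The correction term in `join_insert` therefore vanishes.
-/
theorem IsStable.join_toNextSet_cutCover (hD : IsStable D) {ι : Type w} [DecidableEq ι]
    {x : D.E} {c : ι → Finset D.E} {s : Finset ι} (hs : s.Nonempty) {i : ι}
    (h : ∀ j ∈ insert i s, Admissible D.cover x (c j)) :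
    join (toNextSet D (cutCover x c s i)) =
      of (toNext D (cut x c (insert i s))) + mulNext D (toNext D (cut x c s)) (join (c i)) := by
  have hmem : cut x c s ∈ nextSet D :=
    hD.cut_mem_nextSet hs fun j hj => h j (Finset.mem_insert_of_mem hj)
  have hmem' : cut x c (insert i s) ∈ nextSet D :=
    hD.cut_mem_nextSet (Finset.insert_nonempty i s) h
  set y := toNext D (cut x c s) with hy
  have hval : y.val = cut x c s := toNext_val hmem
  have hle := (h i (Finset.mem_insert_self i s)).le
  have h1 : (toNextSet D (cutCover x c s i)).erase ⊥ =
      (insert (toNext D (cut x c (insert i s)))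
        ((c i).image fun f => toNext D (of f * y.val))).erase ⊥ := by
    ext z
    rw [Finset.mem_erase, Finset.mem_erase, mem_toNextSet, mem_cutCover, Finset.mem_insert,
      Finset.mem_image]
    refine and_congr_right fun hz => ?_
    refine or_congr ⟨fun h => ?_, fun h => ?_⟩ ⟨?_, ?_⟩
    · rw [← h, toNext_coe]
    · rw [h, toNext_val hmem']
    · rintro ⟨-, f, hf, h⟩
      exact ⟨f, hf, by rw [hval, h, toNext_coe]⟩
    · rintro ⟨f, hf, rfl⟩
      exact ⟨fun h => hz (Next.eq_bot_iff.2 h), f, hf, by rw [hD.toNext_mul_val, hval]⟩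
  have h2 : of (toNext D (cut x c (insert i s))) *
      join ((c i).image fun f => toNext D (of f * y.val)) = 0 := by
    refine of_mul_join_eq_zero fun g hg => ?_
    obtain ⟨f, hf, rfl⟩ := Finset.mem_image.1 hg
    rw [Next.eq_bot_iff, Next.coe_inf, hD.toNext_mul_val, toNext_val hmem', cut_insert hle,
      mul_mul_mul_comm, mul_comm _ (of f), of_mul_of_sub_join_of_mem hle hf, zero_mul]
  rw [join_congr h1, join_insert, h2, sub_zero, hD.mulNext_join]

theorem IsStable.incl_join_toNextSet_cutCover (hD : IsStable D) {ι : Type w} [DecidableEq ι]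
    {x : D.E} {c : ι → Finset D.E} {s : Finset ι} (hs : s.Nonempty) {i : ι}
    (h : ∀ j ∈ insert i s, Admissible D.cover x (c j)) :
    incl D (join (toNextSet D (cutCover x c s i))) = cut x c s := by
  rw [hD.join_toNextSet_cutCover hs h, map_add, incl_of, hD.incl_mulNext,
    toNext_val (hD.cut_mem_nextSet (Finset.insert_nonempty i s) h),
    toNext_val (hD.cut_mem_nextSet hs fun j hj => h j (Finset.mem_insert_of_mem hj)),
    cut_insert (h i (Finset.mem_insert_self i s)).le, ← add_mul, sub_add_cancel, of_mul_cut_self]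

theorem IsStable.incl_of_sub_join (hD : IsStable D) {x : Next D} {T : Finset (Next D)}
    (hT : T ∈ nextCover D x) : incl D (of x - join T) = 0 := by
  obtain ⟨e, he, S, hS, hSc, hx, R, hR, -, rfl⟩ := hT
  have hS' : ∀ j ∈ insert R S, Admissible D.cover e (id j) := by
    intro j hj
    rcases Finset.mem_insert.1 hj with rfl | hj
    · exact hD.admissible_cover he hR
    · exact hD.admissible_cover he (hSc j hj)
  rw [map_sub, incl_of, hD.incl_join_toNextSet_cutCover hS hS', hx, sub_self]

/-- A ring homomorphism that kills the generators `x - ⋁ T` kills the subsemigroup they generate. -/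
theorem IsStable.incl_eq_zero (hD : IsStable D) (z : Next D.next) : incl D z.val = 0 := by
  obtain ⟨z, h0, hz⟩ := z
  show incl D z = 0
  clear h0
  induction hz using Subsemigroup.closure_induction with
  | mem y hy =>
    rcases hy with rfl | ⟨x, -, T, hT, rfl⟩
    · exact map_zero _
    · exact hD.incl_of_sub_join hT
  | mul a b _ _ ha hb =>
    have : incl D (a * b) = incl D a * incl D b := incl_mul a b
    rw [this, ha, zero_mul]

theorem cls_of {x : D.E} (hx : x ≠ ⊥) :
    cls D (of x) = Finsupp.single (Quotient.mk'' ⟨x, hx⟩ : Orb D) (1 : ℤ) :=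
  lift_of (fun e => Finsupp.single (Quotient.mk'' e : Orb D) (1 : ℤ)) ⟨x, hx⟩

theorem orbLift_cls {M : Type w} [AddCommGroup M] (φ : Pos D.E → M)
    (hφ : ∀ (g : Γ) (e : Pos D.E), φ (g • e) = φ e) (x : Pos D.E) :
    orbLift D φ hφ (cls D (of (x : D.E))) = φ x := by
  rw [cls_of x.2, orbLift, Finsupp.liftAddHom_apply_single]
  exact one_zsmul _

/-- Homomorphisms on `ℤ[Γ \ E^×]` agree if they agree on the classes `[e]`. -/
theorem zorb_hom_ext {M : Type w} [AddCommGroup M] {φ ψ : ZOrb D →+ M}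
    (h : ∀ x : Pos D.E, φ (cls D (of (x : D.E))) = ψ (cls D (of (x : D.E)))) : φ = ψ := by
  apply Finsupp.addHom_ext'
  intro o
  induction o using Quotient.inductionOn' with
  | h x =>
    apply AddMonoidHom.ext_int
    have := h x
    rwa [cls_of x.2] at this

theorem bdry_cls (z : Zx (Next D)) : bdry D (cls D.next z) = cls D (incl D z) := by
  have : (bdry D).comp (cls D.next) = (cls D).comp (incl D) := by
    apply addHom_ext
    intro x
    refine (orbLift_cls (D := D.next) (fun x => cls D x.1.val)
      (fun g x => cls_act D g x.1.val) x).trans ?_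
    exact congrArg (cls D) (incl_of x.1).symm
  exact DFunLike.congr_fun this z

theorem IsStable.bdry_bdry (hD : IsStable D) : (bdry D).comp (bdry D.next) = 0 := by
  apply zorb_hom_ext
  intro x
  have h1 := (bdry_cls (D := D.next) (of x.1)).trans
    (congrArg (cls D.next) (incl_of (D := D.next) x.1))
  rw [AddMonoidHom.comp_apply]
  exact (congrArg (bdry D) h1).trans
    ((bdry_cls _).trans ((congrArg (cls D) (hD.incl_eq_zero x.1)).trans (map_zero _)))

end Incl

/-! ### Supports of joins -/

section Support

variable {E : Type u} [SemilatticeInf E] [OrderBot E]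

/-- The coefficient of an element of `ℤ[E^×]` at `ε ∈ E^×`. -/
def coeff (ε : Pos E) : Zx E →+ ℤ := (Finsupp.applyAddHom ε : (Pos E →₀ ℤ) →+ ℤ)

theorem mem_supp_iff {z : Zx E} {ε : Pos E} : ε ∈ supp z ↔ coeff ε z ≠ 0 :=
  Finsupp.mem_support_iff

theorem coeff_of (a : E) (ε : Pos E) : coeff ε (of a) = if a = ε then 1 else 0 := by
  by_cases h : a = ⊥
  · subst h
    rw [of_bot, map_zero, if_neg (Ne.symm ε.2)]
  · have := of_pos (⟨a, h⟩ : Pos E)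
    rw [this]
    refine (Finsupp.single_apply).trans ?_
    simp only [Subtype.ext_iff]

theorem coeff_join (A : Finset E) (ε : Pos E) : coeff ε (join A) =
    ∑ J ∈ A.powerset, if h : J.Nonempty then
      (if J.inf' h id = ε then (-1 : ℤ) ^ (J.card + 1) else 0) else 0 := by
  unfold join
  rw [map_sum]
  refine Finset.sum_congr rfl fun J _ => ?_
  split_ifs with h1 h2
  · rw [map_zsmul, coeff_of, if_pos h2, smul_eq_mul, mul_one]
  · rw [map_zsmul, coeff_of, if_neg h2, smul_zero]
  · exact map_zero _

theorem le_of_mem_supp_join {e : E} {A : Finset E} (h : ∀ f ∈ A, f ≤ e) {ε : Pos E}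
    (hε : ε ∈ supp (join A)) : (ε : E) ≤ e := by
  by_contra hle
  refine mem_supp_iff.1 hε ?_
  rw [coeff_join]
  refine Finset.sum_eq_zero fun J hJ => ?_
  split_ifs with h1 h2
  · obtain ⟨f, hf⟩ := h1
    exact absurd (h2 ▸ (Finset.inf'_le id hf).trans (h f (Finset.mem_powerset.1 hJ hf))) hle
  · rfl
  · rfl

/-- The maximal elements of a finite set occur in its join. -/
theorem mem_supp_join_of_maximal {A : Finset E} {ε : Pos E} (h : Maximal (· ∈ A) (ε : E)) :
    ε ∈ supp (join A) := by
  rw [mem_supp_iff]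
  -- If the product over `J` is `ε`, each member of `J` lies above `ε` and equals it by maximality,
  -- so only `J = {ε}` contributes and nothing can cancel it.
  rw [coeff_join, Finset.sum_eq_single {(ε : E)}]
  · simp
  · intro J hJ hJne
    split_ifs with h1 h2
    · refine absurd (Finset.eq_singleton_iff_nonempty_unique_mem.2 ⟨h1, fun f hf => ?_⟩) hJne
      have : (ε : E) ≤ f := h2 ▸ Finset.inf'_le id hf
      exact le_antisymm (h.2 (Finset.mem_powerset.1 hJ hf) this) this
    · rfl
    · rfl
  · intro hn
    exact absurd (Finset.mem_powerset.2 (Finset.singleton_subset_iff.2 h.1)) hn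

/-- Condition (C) is available only for `ε` in the support of a join; this turns it into an identity
for the whole join. -/
theorem hom_congr_of_supp {M : Type w} [AddCommGroup M] {Φ Ψ : Zx E →+ M} {z : Zx E}
    (h : ∀ ε ∈ supp z, Φ (of (ε : E)) = Ψ (of (ε : E))) : Φ z = Ψ z := by
  have hz : z = ∑ ε ∈ supp z, coeff ε z • of (ε : E) := by
    conv_lhs => rw [← Finsupp.sum_single (show Pos E →₀ ℤ from z)]
    refine Finset.sum_congr rfl fun ε _ => ?_
    rw [of_pos]
    refine Eq.trans ?_ (Finsupp.smul_single _ ε (1 : ℤ)).symm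
    rw [smul_eq_mul, mul_one]
    rfl
  rw [hz, map_sum, map_sum]
  refine Finset.sum_congr rfl fun ε hε => ?_
  rw [map_zsmul, map_zsmul, h ε hε]

end Support

/-! ### Restriction of indexed covers to smaller elements -/

section Restricts

variable {n : ℕ}

/-- `w ≤ x`, and the set `c' (π q)` is, up to `⊥`, the product of `w` and `c q` for `q ∈ Q`. -/
structure Restricts {E : Type u} [SemilatticeInf E] [OrderBot E] (w x : E)
    (c' c : Fin n → Finset E) (π : Fin n → Fin n) (Q : Set (Fin n)) : Prop where
  le : w ≤ x
  cover : ∀ q ∈ Q, (c' (π q)).erase ⊥ = mulCover w (c q)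

theorem Restricts.cut_image {E : Type u} [SemilatticeInf E] [OrderBot E] {w x : E}
    {c' c : Fin n → Finset E} {π : Fin n → Fin n} {Q : Set (Fin n)} (h : Restricts w x c' c π Q)
    (hc' : ∀ p, ∀ f ∈ c' p, f ≤ w) {s : Finset (Fin n)} (hs : ∀ q ∈ s, q ∈ Q) :
    cut w c' (s.image π) = of w * cut x c s := by
  rw [IndRes.cut_image π fun q _ => hc' (π q), of_mul_cut, inf_eq_left.2 h.le]
  refine cut_congr fun q hq => ?_
  rw [h.cover q (hs q hq), erase_bot_mulCover]

variable {Γ : Type v} [Group Γ] {D : CoverData.{u} Γ}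

/-- Restriction passes from `E` to `E(E, 𝓡)`. -/
theorem Restricts.next (hD : IsStable D) {w x : D.E} {c' c : Fin n → Finset D.E}
    {π : Fin n → Fin n} {Q : Set (Fin n)} (h : Restricts w x c' c π Q)
    (hc' : ∀ p, Admissible D.cover w (c' p)) (hc : ∀ p, Admissible D.cover x (c p))
    {r : Fin n} (hr : r ∈ Q) :
    Restricts (toNext D (cut w c' {π r})) (toNext D (cut x c {r}))
      (fun p => toNextSet D (cutCover w c' {π r} p)) (fun p => toNextSet D (cutCover x c {r} p))
      π Q := by
  have hcut := h.cut_image (fun p => (hc' p).le) (s := {r}) (by simpa using hr)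
  have hcut' : ∀ q ∈ Q, cut w c' (insert (π q) {π r}) = of w * cut x c (insert q {r}) := by
    intro q hq
    rw [← h.cut_image (fun p => (hc' p).le), Finset.image_insert, Finset.image_singleton]
    simp [hr, hq]
  rw [Finset.image_singleton] at hcut
  have hXX : cut x c {r} * cut x c {r} = cut x c {r} := cut_mul_self fun q _ => (hc q).le
  have hX : (toNext D (cut x c {r})).val = cut x c {r} :=
    toNext_val (hD.cut_mem_nextSet (Finset.singleton_nonempty _) fun q _ => hc q)
  have hW : (toNext D (cut w c' {π r})).val = of w * cut x c {r} := by
    rw [← hcut]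
    exact toNext_val (hD.cut_mem_nextSet (Finset.singleton_nonempty _) fun q _ => hc' q)
  generalize toNext D (cut w c' {π r}) = W at hW ⊢
  refine ⟨?_, fun q hq => ?_⟩
  · rw [Next.le_iff, hW, hX, mul_assoc, hXX]
  have hqX : cut x c (insert q {r}) * cut x c {r} = cut x c (insert q {r}) := by
    rw [cut_insert (hc q).le, mul_assoc, hXX]
  have hsub : ∀ z ∈ cutCover x c {r} q, z ∈ nextSet D := fun z hz =>
    hD.cutCover_subset_nextSet (Finset.singleton_nonempty _) (fun j _ => hc j) hz
  ext z
  rw [Finset.mem_erase, mem_mulCover]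
  refine and_congr_right fun hz => ?_
  have hz' : z.val ≠ 0 := fun h => hz (Next.eq_bot_iff.2 h)
  rw [mem_toNextSet, mem_cutCover, hcut' q hq, hcut]
  constructor
  · rintro (h1 | ⟨-, f, hf, h1⟩)
    · have hm := mem_cutCover (e := x) (c := c) (s := {r}) (i := q) |>.2 (Or.inl rfl)
      refine ⟨⟨_, hsub _ hm⟩, mem_toNextSet D |>.2 hm, Next.ext ?_⟩
      rw [Next.coe_inf, hW, h1, mul_assoc, mul_comm (cut x c {r}), hqX]
    · have hf0 : f ≠ ⊥ := fun h0 => hz' (by rw [← h1, h0, of_bot, zero_mul])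
      have hf' : f ∈ mulCover w (c q) := h.cover q hq ▸ Finset.mem_erase.2 ⟨hf0, hf⟩
      obtain ⟨-, g, hg, rfl⟩ := mem_mulCover.1 hf'
      have h2 : of w * (of g * cut x c {r}) = z.val := by
        rw [← h1, ← of_mul_of, mul_mul_mul_comm, of_mul_self]
      have hm := mem_cutCover (e := x) (c := c) (s := {r}) (i := q) |>.2
        (Or.inr ⟨fun h0 => hz' (by rw [← h2, h0, mul_zero]), g, hg, rfl⟩)
      refine ⟨⟨_, hsub _ hm⟩, mem_toNextSet D |>.2 hm, Next.ext ?_⟩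
      rw [Next.coe_inf, hW, ← h2, mul_assoc, mul_left_comm (cut x c {r}), hXX]
  · rintro ⟨a, ha, rfl⟩
    rw [Next.coe_inf, hW] at hz' ⊢
    rcases mem_cutCover.1 (mem_toNextSet D |>.1 ha) with h1 | ⟨-, g, hg, h1⟩
    · left
      rw [h1, mul_assoc, mul_comm (cut x c {r}), hqX]
    · right
      have h2 : of (w ⊓ g) * (of w * cut x c {r}) = of w * cut x c {r} * a.val := by
        rw [← h1, ← of_mul_of, mul_mul_mul_comm, of_mul_self, mul_assoc, mul_left_comm (cut x c {r}),
          hXX]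
      have hm : w ⊓ g ∈ mulCover w (c q) :=
        mem_mulCover.2 ⟨fun h0 => hz' (by rw [← h2, h0, of_bot, zero_mul]), g, hg, rfl⟩
      rw [← h.cover q hq] at hm
      exact ⟨hz', w ⊓ g, Finset.mem_of_mem_erase hm, h2⟩

/-- Writing `x(s)` for the cut along `s`, one has `x(s ∪ {p}) · x(s ∪ {q}) = x(s ∪ {p, q})` and `x(s
∪ {p}) · f x(s) = f x(s ∪ {p})`. -/
theorem restricts_insert (hD : IsStable D) {x : D.E} {c : Fin n → Finset D.E}
    (hc : ∀ p, Admissible D.cover x (c p)) {s : Finset (Fin n)} (hs : s.Nonempty) (p : Fin n) :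
    Restricts (toNext D (cut x c (insert p s))) (toNext D (cut x c s))
      (fun q => toNextSet D (cutCover x c (insert p s) q)) (fun q => toNextSet D (cutCover x c s q))
      id Set.univ := by
  have hXX : cut x c s * cut x c s = cut x c s := cut_mul_self fun q _ => (hc q).le
  have hX : (toNext D (cut x c s)).val = cut x c s :=
    toNext_val (hD.cut_mem_nextSet hs fun q _ => hc q)
  have hW : (toNext D (cut x c (insert p s))).val = cut x c (insert p s) :=
    toNext_val (hD.cut_mem_nextSet (Finset.insert_nonempty _ _) fun q _ => hc q)
  have hWX : cut x c (insert p s) * cut x c s = cut x c (insert p s) := by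
    rw [cut_insert (hc p).le, mul_assoc, hXX]
  refine ⟨?_, fun q hq => ?_⟩
  · rw [Next.le_iff, hW, hX, hWX]
  have h3 : cut x c (insert p s) * cut x c (insert q s) = cut x c (insert q (insert p s)) := by
    rw [cut_insert (hc q).le, mul_left_comm, hWX, ← cut_insert (hc q).le]
  have hsub : ∀ z ∈ cutCover x c s q, z ∈ nextSet D := fun z hz =>
    hD.cutCover_subset_nextSet hs (fun j _ => hc j) hz
  ext z
  rw [Finset.mem_erase, mem_mulCover]
  refine and_congr_right fun hz => ?_
  have hz' : z.val ≠ 0 := fun h => hz (Next.eq_bot_iff.2 h)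
  rw [mem_toNextSet, mem_cutCover, id]
  constructor
  · rintro (h1 | ⟨-, f, hf, h1⟩)
    · have hm := mem_cutCover (e := x) (c := c) (s := s) (i := q) |>.2 (Or.inl rfl)
      refine ⟨⟨_, hsub _ hm⟩, mem_toNextSet D |>.2 hm, Next.ext ?_⟩
      rw [Next.coe_inf, hW, h1, h3]
    · have h2 : cut x c (insert p s) * (of f * cut x c s) = z.val := by
        rw [mul_left_comm, hWX, h1]
      have hm := mem_cutCover (e := x) (c := c) (s := s) (i := q) |>.2
        (Or.inr ⟨fun h0 => hz' (by rw [← h2, h0, mul_zero]), f, hf, rfl⟩)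
      refine ⟨⟨_, hsub _ hm⟩, mem_toNextSet D |>.2 hm, Next.ext ?_⟩
      rw [Next.coe_inf, hW, h2]
  · rintro ⟨a, ha, rfl⟩
    rw [Next.coe_inf, hW] at hz' ⊢
    rcases mem_cutCover.1 (mem_toNextSet D |>.1 ha) with h1 | ⟨-, f, hf, h1⟩
    · left
      rw [h1, h3]
    · right
      exact ⟨hz', f, hf, by rw [← h1, mul_left_comm, hWX]⟩

end Restricts

/-! ### The join of `R_p(e(q_1 | ... | q_k))` -/

section Eval

variable {Γ : Type v} [Group Γ] {D : CoverData.{u} Γ} {n : ℕ}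

theorem UniformIndexing.mem_cover (I : UniformIndexing D n) {e : D.E} (he : e ≠ ⊥) (p : Fin n) :
    I.R p e ∈ D.cover e := by
  rw [← I.range_eq e he]
  exact ⟨p, rfl⟩

theorem admissible_evalAux (hD : IsStable D) (I : UniformIndexing D n) {e : D.E} (he : e ≠ ⊥)
    (k : ℕ) (μ : Fin k → Finset (Fin n)) (hμ : ∀ j, (μ j).Nonempty) (p : Fin n) :
    Admissible (D.level k).cover (evalAux I.R e k μ).1 ((evalAux I.R e k μ).2 p) := by
  induction k generalizing p with
  | zero => exact hD.admissible_cover he (I.mem_cover he p)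
  | succ k ih =>
    exact (hD.level k).admissible_cutCover (hμ _) fun q _ => ih (Fin.init μ) (fun j => hμ _) q

/-- The elements `e(q_1 | ... | {p, q_j} | ... | q_k)` restrict `e(q_1 | ... | q_k)`. -/
theorem restricts_evalAux_update (hD : IsStable D) (I : UniformIndexing D n) {e : D.E}
    (he : e ≠ ⊥) (p : Fin n) (k : ℕ) (q : Fin k → Fin n) (j : Fin k) :
    Restricts (evalAux I.R e k (Function.update (fun j => {q j}) j {p, q j})).1
      (evalAux I.R e k (fun j => {q j})).1
      (evalAux I.R e k (Function.update (fun j => {q j}) j {p, q j})).2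
      (evalAux I.R e k (fun j => {q j})).2 id Set.univ := by
  induction k with
  | zero => exact j.elim0
  | succ k ih =>
    have hadm : ∀ p, Admissible (D.level k).cover
        (evalAux I.R e k (fun j => {q j.castSucc})).1
        ((evalAux I.R e k (fun j => {q j.castSucc})).2 p) :=
      admissible_evalAux hD I he k _ fun j => Finset.singleton_nonempty _
    induction j using Fin.lastCases with
    | last =>
      have := restricts_insert (hD.level k) hadm (Finset.singleton_nonempty (q (Fin.last k))) p
      simp only [evalAux, Fin.init_update_last, Function.update_self]
      exact this
    | cast j =>
      have hadm' : ∀ r, Admissible (D.level k).cover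
          (evalAux I.R e k (Function.update (fun j => {q j.castSucc}) j {p, q j.castSucc})).1
          ((evalAux I.R e k (Function.update (fun j => {q j.castSucc}) j {p, q j.castSucc})).2 r) := by
        refine admissible_evalAux hD I he k _ fun i => ?_
        by_cases hij : i = j
        · subst hij
          rw [Function.update_self]
          exact Finset.insert_nonempty _ _
        · rw [Function.update_of_ne hij]
          exact Finset.singleton_nonempty _
      have := (ih (fun j => q j.castSucc) j).next (hD.level k) hadm' hadm
        (r := q (Fin.last k)) (Set.mem_univ _)
      simp only [evalAux, Fin.init_update_castSucc,
        Function.update_of_ne (Fin.castSucc_lt_last j).ne']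
      exact this

theorem supp_join_le (hD : IsStable D) (I : UniformIndexing D n) {e : D.E} (he : e ≠ ⊥)
    {p : Fin n} {ε : Pos D.E} (hε : ε ∈ supp (join (I.R p e))) : (ε : D.E) ≤ e :=
  le_of_mem_supp_join (hD.le e he _ (I.mem_cover he p)) hε

/-- The element `ε(p # q_1 | ... | p # q_k)` restricts `e(q_1 | ... | q_k)`. -/
theorem restricts_evalAux_sharp (hD : IsStable D) (I : UniformIndexing D n) {e : D.E}
    (he : e ≠ ⊥) (p : Fin n) {ε : Pos D.E} (hε : ε ∈ supp (join (I.R p e))) (k : ℕ)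
    (q : Fin k → Fin n) (hq : ∀ j, q j ≠ p) :
    Restricts (evalAux I.R (ε : D.E) k (fun j => {I.sharp p (q j)})).1
      (evalAux I.R e k (fun j => {q j})).1
      (evalAux I.R (ε : D.E) k (fun j => {I.sharp p (q j)})).2
      (evalAux I.R e k (fun j => {q j})).2 (I.sharp p) {r | r ≠ p} := by
  induction k with
  | zero =>
    refine ⟨supp_join_le hD I he hε, fun r hr => ?_⟩
    have := I.sharp_spec p r (Ne.symm hr) e he ε hε
    exact (congrArg (fun A => A.erase ⊥) this).symm.trans (erase_bot_mulCover _ _)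
  | succ k ih =>
    exact (ih (fun j => q j.castSucc) fun j => hq _).next (hD.level k)
      (admissible_evalAux hD I ε.2 k _ fun j => Finset.singleton_nonempty _)
      (admissible_evalAux hD I he k _ fun j => Finset.singleton_nonempty _)
      (r := q (Fin.last k)) (hq _)

/-- This is the inductive step of `join_evalAux`: multiplying a term of the level-`k` expansion by
the next cut appends one entry to the tuple of that term. -/
theorem Restricts.toNext_of_mul (hD : IsStable D) {w x : D.E} {c' c : Fin n → Finset D.E}
    {π : Fin n → Fin n} {Q : Set (Fin n)} (h : Restricts w x c' c π Q)
    (hc' : ∀ p, Admissible D.cover w (c' p)) (hc : ∀ p, Admissible D.cover x (c p))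
    {r : Fin n} (hr : r ∈ Q) :
    mulNext D (toNext D (cut x c {r})) (of w) = of (toNext D (cut w c' {π r})) := by
  have hcut := h.cut_image (fun p => (hc' p).le) (s := {r}) (by simpa using hr)
  rw [Finset.image_singleton] at hcut
  rw [mulNext_of, hcut,
    toNext_val (hD.cut_mem_nextSet (Finset.singleton_nonempty _) fun q _ => hc q)]

/-- The join of `R_p(e(q_1 | ... | q_k))`. -/
theorem join_evalAux (hD : IsStable D) (I : UniformIndexing D n) {e : D.E} (he : e ≠ ⊥)
    (p : Fin n) (k : ℕ) (q : Fin k → Fin n) (hq : ∀ j, q j ≠ p) :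
    join ((evalAux I.R e k (fun j => {q j})).2 p) =
      ∑ j, of (evalAux I.R e k (Function.update (fun j => {q j}) j {p, q j})).1 +
      lift (fun ε : Pos D.E => of (evalAux I.R (ε : D.E) k (fun j => {I.sharp p (q j)})).1)
        (join (I.R p e)) := by
  induction k with
  | zero =>
    rw [Finset.univ_eq_empty, Finset.sum_empty, zero_add]
    have : lift (fun ε : Pos D.E => of (ε : D.E)) = AddMonoidHom.id (Zx D.E) := by
      apply addHom_ext; intro ε; exact lift_of _ ε
    exact (DFunLike.congr_fun this (join (I.R p e))).symm
  | succ k ih =>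
    have hadm : ∀ p, Admissible (D.level k).cover
        (evalAux I.R e k (fun j => {q j.castSucc})).1
        ((evalAux I.R e k (fun j => {q j.castSucc})).2 p) :=
      admissible_evalAux hD I he k _ fun j => Finset.singleton_nonempty _
    have h1 := (hD.level k).join_toNextSet_cutCover (Finset.singleton_nonempty (q (Fin.last k)))
      (i := p) fun j _ => hadm j
    rw [ih (fun j => q j.castSucc) fun j => hq _, map_add, map_sum] at h1
    refine h1.trans ?_
    -- The summand `j = last` is the new element of the cover; the others come from the expansion
    -- one level below.
    rw [Fin.sum_univ_castSucc, add_comm (Finset.sum _ _) (of _), add_assoc]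
    refine congrArg₂ (· + ·) ?_ (congrArg₂ (· + ·) (Finset.sum_congr rfl fun j _ => ?_) ?_)
    · simp only [evalAux, Fin.init_update_last, Function.update_self]
      rfl
    · have hadm' : ∀ r, Admissible (D.level k).cover
          (evalAux I.R e k (Function.update (fun j => {q j.castSucc}) j {p, q j.castSucc})).1
          ((evalAux I.R e k (Function.update (fun j => {q j.castSucc}) j {p, q j.castSucc})).2 r) := by
        refine admissible_evalAux hD I he k _ fun i => ?_
        by_cases hij : i = j
        · subst hij
          rw [Function.update_self]
          exact Finset.insert_nonempty _ _
        · rw [Function.update_of_ne hij]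
          exact Finset.singleton_nonempty _
      have := (restricts_evalAux_update hD I he p k (fun j => q j.castSucc) j).toNext_of_mul
        (hD.level k) hadm' hadm (r := q (Fin.last k)) (Set.mem_univ _)
      simp only [evalAux, Fin.init_update_castSucc,
        Function.update_of_ne (Fin.castSucc_lt_last j).ne']
      exact this
    · refine hom_congr_of_supp (Φ := (mulNext (D.level k) _).comp
        (lift fun ε : Pos D.E =>
          of (evalAux I.R (ε : D.E) k (fun j => {I.sharp p (q j.castSucc)})).1)) fun ε hε => ?_
      rw [AddMonoidHom.comp_apply, lift_of]
      refine Eq.trans ?_ (lift_of (fun ε : Pos D.E =>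
        of (evalAux I.R (ε : D.E) (k + 1) (fun j => {I.sharp p (q j)})).1) ε).symm
      exact (restricts_evalAux_sharp hD I he p hε k (fun j => q j.castSucc)
        fun j => hq _).toNext_of_mul (hD.level k)
        (admissible_evalAux hD I ε.2 k _ fun j => Finset.singleton_nonempty _) hadm
        (r := q (Fin.last k)) (hq _)

end Eval

/-! ### Identities for `i # j` and the operators `M_i` -/

section Sharp

variable {Γ : Type v} [Group Γ] {D : CoverData.{u} Γ} {n : ℕ}

theorem mem_supp_join_maximal {E : Type u} [SemilatticeInf E] [OrderBot E] {A : Finset E} {a : E}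
    (ha : a ≠ ⊥) (h : Maximal (· ∈ A) a) : ⟨a, ha⟩ ∈ supp (join A) :=
  mem_supp_join_of_maximal h

/-- For two covers of `e`, there are maximal elements of these covers whose product is non-zero and
maximal among all such products. -/
theorem exists_maximal_inf {E : Type u} [SemilatticeInf E] [OrderBot E] {e : E} (he : e ≠ ⊥)
    {A B : Finset E} (hA : IsFiniteCover e A) (hB : IsFiniteCover e B) :
    ∃ a b : E, Maximal (· ∈ A) a ∧ Maximal (· ∈ B) b ∧ a ⊓ b ≠ ⊥ ∧
      Maximal (· ∈ mulCover a B) (a ⊓ b) ∧ Maximal (· ∈ mulCover b A) (a ⊓ b) := by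
  obtain ⟨a₀, ha₀, -⟩ := hA.2 e he le_rfl
  obtain ⟨b₀, hb₀, hab₀⟩ := hB.2 a₀ (hA.1 a₀ ha₀).1 (hA.1 a₀ ha₀).2
  let P : Finset E := ((A ×ˢ B).image fun x => x.1 ⊓ x.2).erase ⊥
  have hP : ∀ a ∈ A, ∀ b ∈ B, a ⊓ b ≠ ⊥ → a ⊓ b ∈ P := fun a ha b hb h =>
    Finset.mem_erase.2 ⟨h, Finset.mem_image.2 ⟨(a, b), Finset.mk_mem_product ha hb, rfl⟩⟩
  obtain ⟨m, -, hm⟩ := P.exists_le_maximal (hP a₀ ha₀ b₀ hb₀ hab₀)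
  obtain ⟨hm0, hm1⟩ := Finset.mem_erase.1 hm.1
  obtain ⟨⟨a₁, b₁⟩, hab₁, rfl⟩ := Finset.mem_image.1 hm1
  obtain ⟨ha₁, hb₁⟩ := Finset.mem_product.1 hab₁
  obtain ⟨a, haa, ha⟩ := A.exists_le_maximal ha₁
  obtain ⟨b, hbb, hb⟩ := B.exists_le_maximal hb₁
  have hle : a₁ ⊓ b₁ ≤ a ⊓ b := inf_le_inf haa hbb
  have h0 : a ⊓ b ≠ ⊥ := fun h => hm0 (le_bot_iff.1 (hle.trans h.le))
  -- Enlarging both factors to maximal elements cannot change a product that is already maximal in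
  -- `P`.
  have heq : a₁ ⊓ b₁ = a ⊓ b := le_antisymm hle (hm.2 (hP a ha.1 b hb.1 h0) hle)
  simp only at hm
  rw [heq] at hm
  refine ⟨a, b, ha, hb, h0, ⟨mem_mulCover.2 ⟨h0, b, hb.1, rfl⟩, ?_⟩,
    ⟨mem_mulCover.2 ⟨h0, a, ha.1, inf_comm b a⟩, ?_⟩⟩
  · intro y hy hay
    obtain ⟨hy0, f, hf, rfl⟩ := mem_mulCover.1 hy
    exact hm.2 (hP a ha.1 f hf hy0) hay
  · intro y hy hay
    obtain ⟨hy0, f, hf, rfl⟩ := mem_mulCover.1 hy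
    rw [inf_comm b f] at hay hy0 ⊢
    exact hm.2 (hP f hf b hb.1 hy0) hay

/-- If `i # j = i # l`, then `(a R_j(e))^× = (a R_l(e))^×` for a maximal `a ∈ R_i(e)`. So a non-zero
product `a b` with `b ∈ R_j(e)` lies below some element of `R_l(e)`, and multiplying by that element
does not shrink `a b`, against (ii). -/
theorem sharp_ne (hD : IsCoverSystem D) (I : UniformIndexing D n) {e : D.E} (he : e ≠ ⊥)
    {i j l : Fin n} (hij : i ≠ j) (hil : i ≠ l) (hjl : j ≠ l) :
    I.sharp i j ≠ I.sharp i l := by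
  intro heq
  have hc : ∀ p, IsFiniteCover e (I.R p e) := fun p => hD.finite_cover e he _ (I.mem_cover he p)
  obtain ⟨a, b, ha, hb, h0, hab, -⟩ := exists_maximal_inf he (hc i) (hc j)
  have ha0 : a ≠ ⊥ := ((hc i).1 a ha.1).1
  have hb0 : b ≠ ⊥ := ((hc j).1 b hb.1).1
  have haS := mem_supp_join_maximal ha0 ha
  have hbS := mem_supp_join_maximal hb0 hb
  have h1 := hab.1
  simp only at h1
  rw [I.sharp_spec i j hij e he _ haS, heq, ← I.sharp_spec i l hil e he _ haS] at h1
  obtain ⟨-, g, hg, hag⟩ := mem_mulCover.1 h1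
  -- Condition (ii) requires elements of the support; passing from `g` to a maximal `g'` ensures
  -- this and keeps `a ⊓ b ≤ g'`.
  obtain ⟨g', hgg, hg'⟩ := (I.R l e).exists_le_maximal hg
  have hg0 : g' ≠ ⊥ := ((hc l).1 g' hg'.1).1
  have hgS := mem_supp_join_maximal hg0 hg'
  have hinj := I.injective e he
  have hRij : I.R i e ≠ I.R j e := fun h => hij (hinj h)
  have hRil : I.R i e ≠ I.R l e := fun h => hil (hinj h)
  have hRjl : I.R j e ≠ I.R l e := fun h => hjl (hinj h)
  let ε : Finset D.E → Pos D.E := fun R =>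
    if R = I.R i e then ⟨a, ha0⟩ else if R = I.R j e then ⟨b, hb0⟩ else ⟨g', hg0⟩
  have hεi : ε (I.R i e) = ⟨a, ha0⟩ := if_pos rfl
  have hεj : ε (I.R j e) = ⟨b, hb0⟩ := by simp only [ε, if_neg hRij.symm, if_true]
  have hεl : ε (I.R l e) = ⟨g', hg0⟩ := by simp only [ε, if_neg hRil.symm, if_neg hRjl.symm]
  have hmg : a ⊓ b ≤ g' := hag ▸ inf_le_right.trans hgg
  let S : Finset (Finset D.E) := {I.R i e, I.R j e, I.R l e}
  have hS : S.Nonempty := ⟨I.R i e, by simp [S]⟩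
  have hSi : I.R i e ∈ S.erase (I.R l e) := by simp [S, hRil]
  have hSj : I.R j e ∈ S.erase (I.R l e) := by simp [S, hRjl]
  have hle : ∀ R ∈ S, a ⊓ b ≤ (ε R : D.E) := by
    intro R hR
    simp only [S, Finset.mem_insert, Finset.mem_singleton] at hR
    rcases hR with rfl | rfl | rfl
    · rw [hεi]; exact inf_le_left
    · rw [hεj]; exact inf_le_right
    · rw [hεl]; exact hmg
  have h2 : a ⊓ b ≤ prodFrom e S (fun R => (ε R : D.E)) := by
    rw [prodFrom, dif_pos hS]
    exact Finset.le_inf' _ _ hle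
  have h3 : a ⊓ b ≤ prodFrom e (S.erase (I.R l e)) (fun R => (ε R : D.E)) := by
    rw [prodFrom, dif_pos ⟨_, hSi⟩]
    exact Finset.le_inf' _ _ fun R hR => hle R (Finset.mem_of_mem_erase hR)
  have h4 : prodFrom e (S.erase (I.R l e)) (fun R => (ε R : D.E)) ≤ a ⊓ b := by
    rw [prodFrom, dif_pos ⟨_, hSi⟩]
    refine le_inf ?_ ?_
    · refine (Finset.inf'_le _ hSi).trans (le_of_eq ?_)
      rw [hεi]
    · refine (Finset.inf'_le _ hSj).trans (le_of_eq ?_)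
      rw [hεj]
  refine absurd (h4.trans h2) (not_le_of_gt (hD.cond_ii e he S ?_ ε ?_ (I.R l e) (by simp [S]) ?_))
  · intro R hR
    simp only [S, Finset.mem_insert, Finset.mem_singleton] at hR
    rcases hR with rfl | rfl | rfl <;> exact I.mem_cover he _
  · intro R hR
    simp only [S, Finset.mem_insert, Finset.mem_singleton] at hR
    rcases hR with rfl | rfl | rfl
    · rw [hεi]; exact haS
    · rw [hεj]; exact hbS
    · rw [hεl]; exact hgS
  · exact fun h => h0 (le_bot_iff.1 (h3.trans h.le))

/-- At `m = a ⊓ b` both indices give the cover `(m R_l(e))^×`, reached through `a` or through `b`;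
the indexing of covers of `m` is injective. -/
theorem sharp_sharp (hD : IsCoverSystem D) (I : UniformIndexing D n) {e : D.E} (he : e ≠ ⊥)
    {i j l : Fin n} (hij : i ≠ j) (hil : i ≠ l) (hjl : j ≠ l) :
    I.sharp (I.sharp i j) (I.sharp i l) = I.sharp (I.sharp j i) (I.sharp j l) := by
  have hc : ∀ p, IsFiniteCover e (I.R p e) := fun p => hD.finite_cover e he _ (I.mem_cover he p)
  obtain ⟨a, b, ha, hb, h0, hab, hba⟩ := exists_maximal_inf he (hc i) (hc j)
  have key : ∀ {i j : Fin n} {a : D.E}, i ≠ j → i ≠ l → j ≠ l → a ≠ ⊥ → Maximal (· ∈ I.R i e) a →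
      ∀ {m : D.E} (hm : m ≠ ⊥), m ≤ a → Maximal (· ∈ mulCover a (I.R j e)) m →
        I.R (I.sharp (I.sharp i j) (I.sharp i l)) m = mulCover m (I.R l e) := by
    intro i j a hij hil hjl ha0 ha m hm hma hmax
    have haS := mem_supp_join_maximal ha0 ha
    have hmS := mem_supp_join_maximal hm hmax
    -- Maximality of `m` in `(a R_j(e))^× = R_{i#j}(a)` puts it in the support of that join, so (C)
    -- applies a second time, at `a`.
    rw [I.sharp_spec i j hij e he _ haS] at hmS
    have h1 := I.sharp_spec _ _ (sharp_ne hD I he hij hil hjl) a ha0 _ hmS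
    rw [← h1, ← I.sharp_spec i l hil e he _ haS, mulCover_mulCover]
    exact congrArg (fun x => mulCover x (I.R l e)) (inf_eq_left.2 hma)
  refine I.injective _ h0 ?_
  show I.R _ _ = I.R _ _
  rw [key hij hil hjl ((hc i).1 a ha.1).1 ha h0 inf_le_left hab,
    key hij.symm hjl hil ((hc j).1 b hb.1).1 hb h0 inf_le_right hba]

theorem opM_cls (I : UniformIndexing D n) (p : Fin n) (z : Zx D.E) :
    opM I p (cls D z) = cls D (lift (fun ε : Pos D.E => join (I.R p (ε : D.E))) z) := by
  have : (opM I p).comp (cls D)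
      = (cls D).comp (lift fun ε : Pos D.E => join (I.R p (ε : D.E))) := by
    apply addHom_ext
    intro x
    rw [AddMonoidHom.comp_apply, AddMonoidHom.comp_apply, lift_of]
    exact orbLift_cls _ _ x
  exact DFunLike.congr_fun this z

/-- For `ε` in the support of `⋁ R_i(e)`, `⋁ R_{i#j}(ε) = ε · ⋁ R_j(e)`. Both composites thus send
`[e]` to the class of the symmetric product `⋁ R_i(e) · ⋁ R_j(e)`. -/
theorem opM_sharp_comp (I : UniformIndexing D n) {i j : Fin n} (hij : i ≠ j) :
    (opM I (I.sharp i j)).comp (opM I i) = (opM I (I.sharp j i)).comp (opM I j) := by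
  have key : ∀ {i j : Fin n}, i ≠ j → ∀ x : Pos D.E,
      opM I (I.sharp i j) (opM I i (cls D (of (x : D.E)))) =
        cls D (join (I.R i (x : D.E)) * join (I.R j (x : D.E))) := by
    intro i j hij x
    rw [opM_cls, lift_of, opM_cls]
    congr 1
    refine hom_congr_of_supp
      (Ψ := (mulHom : Zx D.E →+ Zx D.E →+ Zx D.E).flip (join (I.R j (x : D.E)))) fun ε hε => ?_
    rw [lift_of, ← I.sharp_spec i j hij x x.2 ε hε, ← of_mul_join]
    rfl
  apply zorb_hom_ext
  intro x
  rw [AddMonoidHom.comp_apply, AddMonoidHom.comp_apply, key hij, key hij.symm, mul_comm]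

end Sharp

/-! ### Boundaries of the elements `e(q_1 | ... | q_{k+1})` -/

section Boundary

variable {Γ : Type v} [Group Γ] {D : CoverData.{u} Γ} {n : ℕ}

theorem evalOrb_cls (I : UniformIndexing D n) (k : ℕ) (μ : Fin k → Finset (Fin n)) (z : Zx D.E) :
    evalOrb I k μ (cls D z) =
      cls (D.level k) (lift (fun ε : Pos D.E => of (evalAux I.R (ε : D.E) k μ).1) z) := by
  have : (evalOrb I k μ).comp (cls D) = (cls (D.level k)).comp
      (lift fun ε : Pos D.E => of (evalAux I.R (ε : D.E) k μ).1) := by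
    apply addHom_ext
    intro x
    rw [AddMonoidHom.comp_apply, AddMonoidHom.comp_apply, lift_of]
    exact orbLift_cls _ _ x
  exact DFunLike.congr_fun this z

/-- The boundary of `e(q_1 | ... | q_{k+1})`. -/
theorem bdryC_comp_evalOrb (hD : IsStable D) (I : UniformIndexing D n) (k : ℕ)
    (q : Fin (k + 1) → Fin n) (hq : ∀ j : Fin k, q j.castSucc ≠ q (Fin.last k)) :
    (bdryC D k).comp (evalOrb I (k + 1) fun j => {q j}) =
      evalOrb I k (fun j => {q j.castSucc})
      - ∑ j : Fin k, evalOrb I k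
          (Function.update (fun j => {q j.castSucc}) j {q (Fin.last k), q j.castSucc})
      - (evalOrb I k fun j => {I.sharp (q (Fin.last k)) (q j.castSucc)}).comp
          (opM I (q (Fin.last k))) := by
  apply zorb_hom_ext
  intro x
  have hadm : ∀ p, Admissible (D.level k).cover
      (evalAux I.R (x : D.E) k (fun j => {q j.castSucc})).1
      ((evalAux I.R (x : D.E) k (fun j => {q j.castSucc})).2 p) :=
    admissible_evalAux hD I x.2 k _ fun j => Finset.singleton_nonempty _
  have h1 : bdryC D k (evalOrb I (k + 1) (fun j => {q j}) (cls D (of (x : D.E)))) =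
      cls (D.level k) (of (evalAux I.R (x : D.E) k (fun j => {q j.castSucc})).1 -
        join ((evalAux I.R (x : D.E) k (fun j => {q j.castSucc})).2 (q (Fin.last k)))) := by
    rw [evalOrb_cls, lift_of]
    refine (bdry_cls _).trans (congrArg _ ((incl_of _).trans ?_))
    refine (toNext_val ((hD.level k).cut_mem_nextSet (Finset.singleton_nonempty _)
      fun p _ => hadm p)).trans ?_
    exact cut_singleton (hadm _).le
  have h2 : evalOrb I k (fun j => {I.sharp (q (Fin.last k)) (q j.castSucc)})
      (opM I (q (Fin.last k)) (cls D (of (x : D.E)))) =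
      cls (D.level k) (lift (fun ε : Pos D.E => of (evalAux I.R (ε : D.E) k
        (fun j => {I.sharp (q (Fin.last k)) (q j.castSucc)})).1)
        (join (I.R (q (Fin.last k)) (x : D.E)))) := by
    rw [opM_cls, lift_of, evalOrb_cls]
  have h3 : ∀ μ, evalOrb I k μ (cls D (of (x : D.E))) =
      cls (D.level k) (of (evalAux I.R (x : D.E) k μ).1) := fun μ => by
    rw [evalOrb_cls, lift_of]
  rw [AddMonoidHom.comp_apply, h1, AddMonoidHom.sub_apply, AddMonoidHom.sub_apply,
    AddMonoidHom.comp_apply, h2, AddMonoidHom.finsetSum_apply,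
    join_evalAux hD I x.2 _ k (fun j => q j.castSucc) hq, map_sub, map_add, map_sum, h3,
    Finset.sum_congr rfl fun j _ => h3 _]
  abel

end Boundary

/-! ### Permutations with a prescribed value, and their signs -/

section Perm

/-- The permutation of `Fin (k + 1)` that sends `a` to `i` and acts as `σ` on the complements. -/
def insertPerm {k : ℕ} (a i : Fin (k + 1)) (σ : Equiv.Perm (Fin k)) : Equiv.Perm (Fin (k + 1)) :=
  (Fin.cycleRange i)⁻¹ * Equiv.Perm.decomposeFin.symm (0, σ) * Fin.cycleRange a

theorem insertPerm_self {k : ℕ} (a i : Fin (k + 1)) (σ : Equiv.Perm (Fin k)) :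
    insertPerm a i σ a = i := by
  simp [insertPerm, Equiv.Perm.inv_def]

theorem insertPerm_succAbove {k : ℕ} (a i : Fin (k + 1)) (σ : Equiv.Perm (Fin k)) (j : Fin k) :
    insertPerm a i σ (a.succAbove j) = i.succAbove (σ j) := by
  simp [insertPerm, Equiv.Perm.inv_def]

/-- `Fin.cycleRange a` is a cycle of length `a + 1`, hence of sign `(-1)^a`, and adjoining a fixed
point to `σ` keeps its sign. -/
theorem sign_insertPerm {k : ℕ} (a i : Fin (k + 1)) (σ : Equiv.Perm (Fin k)) :
    ((Equiv.Perm.sign (insertPerm a i σ) : ℤˣ) : ℤ) =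
      (-1) ^ (i : ℕ) * (-1) ^ (a : ℕ) * ((Equiv.Perm.sign σ : ℤˣ) : ℤ) := by
  simp only [insertPerm, Equiv.Perm.sign_mul, Equiv.Perm.sign_inv, Fin.sign_cycleRange,
    Equiv.Perm.decomposeFin.symm_sign, if_true, one_mul, Units.val_mul, Units.val_pow_eq_pow_val,
    Units.val_neg, Units.val_one]
  ring

theorem insertPerm_bijective {k : ℕ} (a : Fin (k + 1)) :
    Function.Bijective fun x : Fin (k + 1) × Equiv.Perm (Fin k) => insertPerm a x.1 x.2 := by
  rw [Fintype.bijective_iff_injective_and_card]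
  constructor
  · rintro ⟨i, σ⟩ ⟨i', σ'⟩ h
    simp only at h
    have hi : i = i' := by rw [← insertPerm_self a i σ, h, insertPerm_self]
    subst hi
    refine Prod.ext rfl (Equiv.ext fun j => ?_)
    apply Fin.succAbove_right_injective (p := i)
    rw [← insertPerm_succAbove a, h, insertPerm_succAbove]
  · simp [Fintype.card_perm, Nat.factorial_succ]

theorem sum_perm_eq_sum_insertPerm {k : ℕ} {B : Type*} [AddCommMonoid B] (a : Fin (k + 1))
    (F : Equiv.Perm (Fin (k + 1)) → B) :
    ∑ σ, F σ = ∑ i, ∑ σ : Equiv.Perm (Fin k), F (insertPerm a i σ) := by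
  rw [← Fintype.sum_prod_type' fun i σ => F (insertPerm a i σ)]
  exact (Fintype.sum_bijective _ (insertPerm_bijective a) _ _ fun _ => rfl).symm

end Perm

/-! ### Alternating families, the complex `C̃` and the chain map -/

section Pairing

variable {Γ : Type v} [Group Γ] {D : CoverData.{u} Γ} {n k : ℕ} {B : Type w} [AddCommGroup B]

/-- The homomorphism `⊕ x_μ ↦ ∑ φ_μ(x_μ)` on a group of `C̃`. -/
def pairing (φ : (Fin k → Fin n) → ZOrb D →+ B) : Ct D n k →+ B :=
  ∑ μ : NTuple n k, (φ μ.1).comp (Pi.evalAddMonoidHom _ μ)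

theorem pairing_apply (φ : (Fin k → Fin n) → ZOrb D →+ B) (x : Ct D n k) :
    pairing φ x = ∑ μ : NTuple n k, φ μ.1 (x μ) := by
  simp [pairing, AddMonoidHom.finsetSum_apply]

/-- Alternating families of homomorphisms, indexed by the injective tuples. -/
def IsAlternating (φ : (Fin k → Fin n) → ZOrb D →+ B) : Prop :=
  ∀ p : Fin k → Fin n, Function.Injective p → ∀ τ : Equiv.Perm (Fin k),
    φ (p ∘ τ) = ((Equiv.Perm.sign τ : ℤˣ) : ℤ) • φ p

/-- The transpose of the connecting maps of `C̃`, on families indexed by all tuples. -/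
def codiff (I : UniformIndexing D n) (φ : (Fin k → Fin n) → ZOrb D →+ B)
    (p : Fin (k + 1) → Fin n) : ZOrb D →+ B :=
  ∑ i : Fin (k + 1), (-1 : ℤ) ^ (i : ℕ) •
    (φ (omit' p i) - (φ (sharpOmit I p i)).comp (opM I (p i)))

theorem sign_mul_sign (τ : Equiv.Perm (Fin k)) :
    ((Equiv.Perm.sign τ : ℤˣ) : ℤ) * ((Equiv.Perm.sign τ : ℤˣ) : ℤ) = 1 := by
  rw [← Units.val_mul, Int.units_mul_self, Units.val_one]

/-- The index `i # j` is injective in `j ≠ i`. -/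
def SharpInjective (I : UniformIndexing D n) : Prop :=
  ∀ i j l : Fin n, i ≠ j → i ≠ l → j ≠ l → I.sharp i j ≠ I.sharp i l

theorem omit'_injective {p : Fin (k + 1) → Fin n} (hp : Function.Injective p) (i : Fin (k + 1)) :
    Function.Injective (omit' p i) :=
  hp.comp Fin.succAbove_right_injective

theorem SharpInjective.sharpOmit {I : UniformIndexing D n} (hI : SharpInjective I)
    {p : Fin (k + 1) → Fin n} (hp : Function.Injective p) (i : Fin (k + 1)) :
    Function.Injective (sharpOmit I p i) := by
  intro j l h
  by_contra hjl
  exact hI _ _ _ (fun h' => Fin.succAbove_ne i j (hp h').symm)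
    (fun h' => Fin.succAbove_ne i l (hp h').symm)
    (fun h' => hjl (omit'_injective hp i h')) h

theorem sum_ntuple_ite (φ : (Fin k → Fin n) → ZOrb D →+ B) {ν : Fin k → Fin n} (hν : StrictMono ν)
    (a : ZOrb D) : ∑ l : NTuple n k, φ l.1 (if l.1 = ν then a else 0) = φ ν a := by
  rw [Finset.sum_eq_single (⟨ν, hν⟩ : NTuple n k)]
  · rw [if_pos rfl]
  · intro l _ hl
    rw [if_neg fun h => hl (Subtype.ext h), map_zero]
  · intro h
    exact absurd (Finset.mem_univ _) h

/-- On an alternating family, replacing the sorted tuple by `μ_i # μ^i` itself costs the sign of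
`ρ_{μ,i}`, which cancels the sign in `dC`. Injectivity of `#` makes the sorted tuple strictly
increasing, hence an actual index of `C̃`. -/
theorem pairing_dC {I : UniformIndexing D n} (hI : SharpInjective I)
    {φ : (Fin k → Fin n) → ZOrb D →+ B} (hφ : IsAlternating φ) (x : Ct D n (k + 1)) :
    pairing φ (dC I k x) = pairing (codiff I φ) x := by
  rw [pairing_apply, pairing_apply]
  have h1 : ∀ l : NTuple n k, φ l.1 (dC I k x l) =
      ∑ μ : NTuple n (k + 1), ∑ i : Fin (k + 1), (-1 : ℤ) ^ (i : ℕ) •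
        (φ l.1 (if l.1 = omit' μ.1 i then x μ else 0)
          - ((Equiv.Perm.sign (rho I μ.1 i) : ℤˣ) : ℤ) • φ l.1
            (if l.1 = sharpOmit I μ.1 i ∘ rho I μ.1 i then opM I (μ.1 i) (x μ) else 0)) := by
    intro l
    refine (map_sum _ _ _).trans (Finset.sum_congr rfl fun μ _ => ?_)
    refine (map_sum _ _ _).trans (Finset.sum_congr rfl fun i _ => ?_)
    rw [map_zsmul, map_sub, map_zsmul]
  rw [Finset.sum_congr rfl fun l _ => h1 l, Finset.sum_comm]
  refine Finset.sum_congr rfl fun μ _ => ?_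
  rw [Finset.sum_comm, codiff, AddMonoidHom.finsetSum_apply]
  refine Finset.sum_congr rfl fun i _ => ?_
  have hinj := hI.sharpOmit μ.2.injective i
  have hmono : StrictMono (sharpOmit I μ.1 i ∘ rho I μ.1 i) :=
    (Tuple.monotone_sort _).strictMono_of_injective (hinj.comp (Equiv.injective _))
  have homit : StrictMono (omit' μ.1 i) := μ.2.comp (Fin.strictMono_succAbove i)
  rw [← Finset.smul_sum, Finset.sum_sub_distrib, ← Finset.smul_sum,
    sum_ntuple_ite φ homit, sum_ntuple_ite φ hmono,
    hφ _ hinj, AddMonoidHom.smul_apply, smul_smul, sign_mul_sign, one_smul]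
  rfl

theorem IsAlternating.codiff {I : UniformIndexing D n} (hI : SharpInjective I)
    {φ : (Fin k → Fin n) → ZOrb D →+ B} (hφ : IsAlternating φ) :
    IsAlternating (codiff I φ) := by
  intro p hp τ
  unfold IndRes.codiff
  rw [Finset.smul_sum]
  refine Fintype.sum_equiv τ _ _ fun i => ?_
  -- Removing entry `i` from `p ∘ τ` is removing entry `i' = τ i` from `p` and permuting by the
  -- induced `σ`; the signs then agree by `sign_insertPerm`.
  obtain ⟨⟨i', σ⟩, hσ⟩ := (insertPerm_bijective i).2 τ
  simp only at hσ
  have hi : τ i = i' := by rw [← hσ, insertPerm_self]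
  have h1 : omit' (p ∘ τ) i = omit' p i' ∘ σ := by
    funext j
    simp only [omit', Function.comp, ← hσ, insertPerm_succAbove]
  have h2 : sharpOmit I (p ∘ τ) i = sharpOmit I p i' ∘ σ := by
    funext j
    simp only [sharpOmit, h1, Function.comp, hi]
  rw [h1, h2, hφ _ (omit'_injective hp i'), hφ _ (hI.sharpOmit hp i'), hi, Function.comp, hi,
    ← hσ, sign_insertPerm]
  have h3 : ∀ (c : ℤ) (ψ : ZOrb D →+ B) (χ : ZOrb D →+ ZOrb D),
      (c • ψ).comp χ = c • ψ.comp χ := fun _ _ _ => rfl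
  rw [h3, ← smul_sub, smul_smul, smul_smul]
  congr 1
  have h4 : ((-1 : ℤ) ^ (i' : ℕ)) * (-1) ^ (i' : ℕ) = 1 := by
    rw [← mul_pow]; simp
  linear_combination (-((-1) ^ (i : ℕ) * ((Equiv.Perm.sign σ : ℤˣ) : ℤ))) * h4

theorem codiff_codiff {I : UniformIndexing D n}
    (hs : ∀ i j l : Fin n, i ≠ j → i ≠ l → j ≠ l →
      I.sharp (I.sharp i j) (I.sharp i l) = I.sharp (I.sharp j i) (I.sharp j l))
    (φ : (Fin k → Fin n) → ZOrb D →+ B) {p : Fin (k + 2) → Fin n} (hp : Function.Injective p) :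
    codiff I (codiff I φ) p = 0 := by
  let r : Fin (k + 2) → Fin (k + 1) → Fin k → Fin n := fun i j => omit' (omit' p i) j
  -- `H i j` collects the four terms in which entries `i` and `i.succAbove j` are removed, each
  -- either plainly or through `#` and its operator.
  let H : Fin (k + 2) → Fin (k + 1) → (ZOrb D →+ B) := fun i j =>
    φ (r i j) - (φ fun m => I.sharp (p (i.succAbove j)) (r i j m)).comp (opM I (p (i.succAbove j)))
      - (φ fun m => I.sharp (p i) (r i j m)).comp (opM I (p i))
      + (φ fun m => I.sharp (I.sharp (p i) (p (i.succAbove j))) (I.sharp (p i) (r i j m))).comp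
          ((opM I (I.sharp (p i) (p (i.succAbove j)))).comp (opM I (p i)))
  have hH : codiff I (codiff I φ) p =
      ∑ x : Fin (k + 2) × Fin (k + 1), (-1 : ℤ) ^ ((x.1 : ℕ) + x.2) • H x.1 x.2 := by
    rw [Fintype.sum_prod_type]
    refine Finset.sum_congr rfl fun i _ => ?_
    have hcomp : (codiff I φ (sharpOmit I p i)).comp (opM I (p i)) =
        ∑ j : Fin (k + 1), (-1 : ℤ) ^ (j : ℕ) •
          ((φ (omit' (sharpOmit I p i) j)).comp (opM I (p i)) -
            (φ (sharpOmit I (sharpOmit I p i) j)).comp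
              ((opM I (sharpOmit I p i j)).comp (opM I (p i)))) := by
      refine AddMonoidHom.ext fun x => ?_
      simp [codiff, AddMonoidHom.finsetSum_apply]
    rw [hcomp, codiff, ← Finset.sum_sub_distrib, Finset.smul_sum]
    refine Finset.sum_congr rfl fun j _ => ?_
    rw [← smul_sub, smul_smul, ← pow_add]
    congr 1
    show φ (r i j) - (φ fun m => I.sharp (p (i.succAbove j)) (r i j m)).comp
        (opM I (p (i.succAbove j))) -
      ((φ fun m => I.sharp (p i) (r i j m)).comp (opM I (p i)) -
        (φ fun m => I.sharp (I.sharp (p i) (p (i.succAbove j))) (I.sharp (p i) (r i j m))).comp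
          ((opM I (I.sharp (p i) (p (i.succAbove j)))).comp (opM I (p i)))) = H i j
    simp only [H]
    abel
  rw [hH]
  -- The involution removes the same two entries in the other order. It preserves `H` and changes
  -- the sign.
  refine Finset.sum_involution (fun x _ => (x.1.succAbove x.2, x.2.predAbove x.1)) ?_ ?_
    (fun _ _ => Finset.mem_univ _) ?_
  · rintro ⟨i, j⟩ -
    simp only
    have hr : r (i.succAbove j) (j.predAbove i) = r i j := by
      funext m
      exact congrArg p (Fin.succAbove_succAbove_succAbove_predAbove i j m)
    have hij : p i ≠ p (i.succAbove j) := fun h => Fin.succAbove_ne i j (hp h).symm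
    have hrm : ∀ m, r i j m ≠ p (i.succAbove j) := fun m h =>
      Fin.succAbove_ne j m (Fin.succAbove_right_injective (hp h))
    have hrm' : ∀ m, r i j m ≠ p i := fun m h => Fin.succAbove_ne i _ (hp h)
    have hsym : H (i.succAbove j) (j.predAbove i) = H i j := by
      simp only [H, hr, Fin.succAbove_succAbove_predAbove]
      rw [opM_sharp_comp I hij, show (fun m => I.sharp (I.sharp (p (i.succAbove j)) (p i))
        (I.sharp (p (i.succAbove j)) (r i j m))) =
        fun m => I.sharp (I.sharp (p i) (p (i.succAbove j))) (I.sharp (p i) (r i j m)) from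
          funext fun m => (hs _ _ _ hij (hrm' m).symm (hrm m).symm).symm]
      abel
    rw [hsym, Fin.neg_one_pow_succAbove_add_predAbove, neg_smul, add_neg_cancel]
  · rintro ⟨i, j⟩ - - h
    exact Fin.succAbove_ne i j (Prod.ext_iff.1 h).1
  · rintro ⟨i, j⟩ -
    exact Prod.ext (Fin.succAbove_succAbove_predAbove i j) (Fin.predAbove_predAbove_succAbove i j)

/-- The alternating family obtained by antisymmetrization. -/
def antisymm (φ : (Fin k → Fin n) → ZOrb D →+ B) (p : Fin k → Fin n) : ZOrb D →+ B :=
  ∑ σ : Equiv.Perm (Fin k), ((Equiv.Perm.sign σ : ℤˣ) : ℤ) • φ (p ∘ σ)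

theorem isAlternating_antisymm (φ : (Fin k → Fin n) → ZOrb D →+ B) :
    IsAlternating (antisymm φ) := by
  intro p _ τ
  unfold antisymm
  rw [Finset.smul_sum]
  refine Fintype.sum_equiv (Equiv.mulLeft τ) _ _ fun σ => ?_
  rw [Equiv.coe_mulLeft, Equiv.Perm.sign_mul, Units.val_mul, smul_smul, ← mul_assoc,
    sign_mul_sign, one_mul]
  rfl

theorem strictMono_comp_perm {μ : Fin k → Fin n} (hμ : StrictMono μ) {σ : Equiv.Perm (Fin k)}
    (h : StrictMono (μ ∘ σ)) : σ = 1 := by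
  have h1 : StrictMono σ := fun a b hab => hμ.lt_iff_lt.1 (h hab)
  have h2 := Subsingleton.elim (h1.orderIsoOfSurjective _ σ.surjective) (OrderIso.refl _)
  ext j
  exact congrArg Fin.val (DFunLike.congr_fun h2 j)

/-- The coordinates of `C̃` are pairings with alternating families. -/
theorem exists_pairing_eq_apply (l : NTuple n k) :
    ∃ φ : (Fin k → Fin n) → ZOrb D →+ ZOrb D, IsAlternating φ ∧
      ∀ x : Ct D n k, pairing φ x = x l := by
  refine ⟨antisymm fun p => if p = l.1 then AddMonoidHom.id _ else 0,
    isAlternating_antisymm _, fun x => ?_⟩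
  rw [pairing_apply]
  have h : ∀ μ : NTuple n k,
      antisymm (fun p => if p = l.1 then AddMonoidHom.id (ZOrb D) else 0) μ.1 (x μ) =
        if μ = l then x μ else 0 := by
    intro μ
    -- The family antisymmetrized is the indicator of `l`. Only the trivial permutation takes one
    -- increasing tuple to another.
    rw [antisymm, Finset.sum_eq_single 1]
    · rw [Equiv.Perm.sign_one, Units.val_one, one_smul]
      by_cases h : μ = l
      · rw [if_pos h, if_pos (show μ.1 ∘ (1 : Equiv.Perm (Fin k)) = l.1 from congrArg Subtype.val h)]
        rfl
      · rw [if_neg h,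
          if_neg fun h' : μ.1 ∘ (1 : Equiv.Perm (Fin k)) = l.1 => h (Subtype.ext h')]
        rfl
    · intro σ _ hσ
      rw [if_neg, smul_zero]
      intro hl
      exact hσ (strictMono_comp_perm μ.2 (hl ▸ l.2))
    · intro h
      exact absurd (Finset.mem_univ _) h
  rw [Finset.sum_congr rfl fun μ _ => h μ, Finset.sum_ite_eq' Finset.univ l x,
    if_pos (Finset.mem_univ _)]

theorem dC_comp_dC {I : UniformIndexing D n} (hI : SharpInjective I)
    (hs : ∀ i j l : Fin n, i ≠ j → i ≠ l → j ≠ l →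
      I.sharp (I.sharp i j) (I.sharp i l) = I.sharp (I.sharp j i) (I.sharp j l)) (k : ℕ) :
    (dC I k).comp (dC I (k + 1)) = 0 := by
  refine AddMonoidHom.ext fun x => ?_
  funext l
  obtain ⟨φ, hφ, hl⟩ := exists_pairing_eq_apply (D := D) l
  refine (hl _).symm.trans ?_
  rw [AddMonoidHom.comp_apply, pairing_dC hI hφ, pairing_dC hI (hφ.codiff hI),
    pairing_apply]
  refine Finset.sum_eq_zero fun μ _ => ?_
  rw [codiff_codiff hs φ μ.2.injective]
  rfl

theorem fC_eq_pairing (I : UniformIndexing D n) (k : ℕ) (x : Ct D n k) :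
    fC I k x = (-1 : ℤ) ^ aSeq k • pairing (antisymm fun p => evalOrb I k fun j => {p j}) x := by
  rw [pairing_apply, Finset.smul_sum]
  refine Finset.sum_congr rfl fun μ _ => ?_
  rw [antisymm, AddMonoidHom.finsetSum_apply, Finset.smul_sum]
  refine Finset.sum_congr rfl fun σ _ => ?_
  rw [AddMonoidHom.smul_apply, smul_smul, mul_comm]
  rfl

/-- The sum over permutations is grouped by the index `i` of the entry placed last; moving it there
produces the sign `(-1)^i (-1)^k`. -/
theorem bdryC_comp_antisymm (hD : IsStable D) (I : UniformIndexing D n) (k : ℕ)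
    {p : Fin (k + 1) → Fin n} (hp : Function.Injective p) :
    (bdryC D k).comp (antisymm (fun p => evalOrb I (k + 1) fun j => {p j}) p) =
      (-1 : ℤ) ^ k • codiff I (antisymm fun p => evalOrb I k fun j => {p j}) p := by
  have h1 : (bdryC D k).comp (antisymm (fun p => evalOrb I (k + 1) fun j => {p j}) p) =
      ∑ σ : Equiv.Perm (Fin (k + 1)), ((Equiv.Perm.sign σ : ℤˣ) : ℤ) •
        (bdryC D k).comp (evalOrb I (k + 1) fun j => {(p ∘ σ) j}) := by
    refine AddMonoidHom.ext fun x => ?_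
    simp only [antisymm, AddMonoidHom.comp_apply, AddMonoidHom.finsetSum_apply, map_sum,
      AddMonoidHom.smul_apply, map_zsmul]
  have h2 : ∑ σ : Equiv.Perm (Fin (k + 1)), ((Equiv.Perm.sign σ : ℤˣ) : ℤ) • ∑ j : Fin k,
      evalOrb I k (Function.update (fun j => {(p ∘ σ) j.castSucc}) j
        {(p ∘ σ) (Fin.last k), (p ∘ σ) j.castSucc}) = 0 := by
    simp only [Finset.smul_sum]
    rw [Finset.sum_comm]
    refine Finset.sum_eq_zero fun j _ => ?_
    have hne : j.castSucc ≠ Fin.last k := (Fin.castSucc_lt_last j).ne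
    -- Swapping positions `j` and last leaves the unordered pair in slot `j` unchanged and reverses
    -- the sign.
    refine Finset.sum_involution (fun σ _ => σ * Equiv.swap j.castSucc (Fin.last k)) ?_ ?_
      (fun _ _ => Finset.mem_univ _) ?_
    · intro σ _
      have : (Function.update (fun i : Fin k => ({(p ∘ ⇑(σ * Equiv.swap j.castSucc (Fin.last k)))
          i.castSucc} : Finset (Fin n))) j
          {(p ∘ ⇑(σ * Equiv.swap j.castSucc (Fin.last k))) (Fin.last k),
            (p ∘ ⇑(σ * Equiv.swap j.castSucc (Fin.last k))) j.castSucc}) =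
          Function.update (fun i : Fin k => {(p ∘ σ) i.castSucc}) j
            {(p ∘ σ) (Fin.last k), (p ∘ σ) j.castSucc} := by
        funext i
        by_cases hij : i = j
        · subst hij
          simp [Finset.pair_comm]
        · rw [Function.update_of_ne hij, Function.update_of_ne hij]
          have h3 : i.castSucc ≠ j.castSucc := fun h => hij (Fin.castSucc_injective k h)
          simp [Equiv.swap_apply_of_ne_of_ne h3 (Fin.castSucc_lt_last i).ne]
      rw [this, Equiv.Perm.sign_mul, Equiv.Perm.sign_swap hne]
      simp
    · intro σ _ _ h
      exact hne (Equiv.swap_eq_one_iff.1 (mul_eq_left.1 h))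
    · intro σ _
      simp [mul_assoc]
  have h3 : ∀ σ : Equiv.Perm (Fin (k + 1)), (bdryC D k).comp
      (evalOrb I (k + 1) fun j => {(p ∘ σ) j}) = _ := fun σ =>
    bdryC_comp_evalOrb hD I k (p ∘ σ) fun j h =>
      (Fin.castSucc_lt_last j).ne (σ.injective (hp h))
  rw [h1, Finset.sum_congr rfl fun σ _ => congrArg _ (h3 σ)]
  simp only [smul_sub, Finset.sum_sub_distrib]
  rw [h2, sub_zero, ← Finset.sum_sub_distrib, sum_perm_eq_sum_insertPerm (Fin.last k), codiff,
    Finset.smul_sum]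
  refine Finset.sum_congr rfl fun i _ => ?_
  have h4 : (antisymm (fun p => evalOrb I k fun j => {p j}) (sharpOmit I p i)).comp
      (opM I (p i)) = ∑ σ : Equiv.Perm (Fin k), ((Equiv.Perm.sign σ : ℤˣ) : ℤ) •
        (evalOrb I k fun j => {(sharpOmit I p i ∘ σ) j}).comp (opM I (p i)) := by
    refine AddMonoidHom.ext fun x => ?_
    simp only [antisymm, AddMonoidHom.comp_apply, AddMonoidHom.finsetSum_apply,
      AddMonoidHom.smul_apply]
  rw [h4, antisymm, ← Finset.sum_sub_distrib, smul_smul, Finset.smul_sum]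
  refine Finset.sum_congr rfl fun σ _ => ?_
  have h5 : ∀ j : Fin k, insertPerm (Fin.last k) i σ j.castSucc = i.succAbove (σ j) := fun j => by
    rw [← Fin.succAbove_last, insertPerm_succAbove]
  simp only [Function.comp, h5, insertPerm_self]
  rw [← smul_sub, ← smul_sub, smul_smul, sign_insertPerm, Fin.val_last,
    mul_comm ((-1 : ℤ) ^ (i : ℕ))]
  rfl

theorem bdryC_comp_fC (hD : IsStable D) {I : UniformIndexing D n} (hI : SharpInjective I) (k : ℕ) :
    (bdryC D k).comp (fC I (k + 1)) = (fC I k).comp (dC I k) := by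
  refine AddMonoidHom.ext fun x => ?_
  rw [AddMonoidHom.comp_apply, AddMonoidHom.comp_apply, fC_eq_pairing, fC_eq_pairing,
    pairing_dC hI (isAlternating_antisymm _), map_zsmul, pairing_apply, pairing_apply, map_sum,
    Finset.smul_sum, Finset.smul_sum]
  refine Finset.sum_congr rfl fun μ _ => ?_
  rw [← AddMonoidHom.comp_apply, bdryC_comp_antisymm hD I k μ.2.injective,
    AddMonoidHom.smul_apply, smul_smul, ← pow_add]
  congr 1
  -- The recursion for `a_k` is chosen so that the sign `(-1)^k` of `bdryC_comp_antisymm` is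
  -- absorbed.
  rw [show aSeq (k + 1) + k = aSeq k + 2 * k by simp only [aSeq]; ring, pow_add, pow_mul]
  simp

end Pairing

end IndRes

end

theorem mainTheorem7 {Γ : Type*} [Group Γ] (D : IndRes.CoverData Γ) (hD : IndRes.IsCoverSystem D)
    (hfree : IndRes.ActsFreely D) (n : ℕ) (I : IndRes.UniformIndexing D n) :
    (∀ k : ℕ, (IndRes.dC I k).comp (IndRes.dC I (k + 1)) = 0) ∧
    (∀ k : ℕ, (IndRes.bdryC D k).comp (IndRes.bdryC D (k + 1)) = 0) ∧
    (∀ k : ℕ, (IndRes.bdryC D k).comp (IndRes.fC I (k + 1))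
      = (IndRes.fC I k).comp (IndRes.dC I k)) := by
  have hS := hD.isStable
  -- The identities for `#` concern indices only, but their proofs evaluate covers at some `e ≠ ⊥`.
  -- Without such an element the groups of `C̃` vanish.
  by_cases hE : ∃ e : D.E, e ≠ ⊥
  · obtain ⟨e, he⟩ := hE
    have hI : IndRes.SharpInjective I := fun i j l => IndRes.sharp_ne hD I he
    exact ⟨IndRes.dC_comp_dC hI fun i j l => IndRes.sharp_sharp hD I he,
      fun k => (hS.level k).bdry_bdry, IndRes.bdryC_comp_fC hS hI⟩
  · have : IsEmpty (IndRes.Pos D.E) := ⟨fun e => hE ⟨e.1, e.2⟩⟩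
    have : IsEmpty (IndRes.Orb D) := ⟨fun o => Quotient.inductionOn' o isEmptyElim⟩
    refine ⟨fun k => AddMonoidHom.ext fun x => ?_, fun k => (hS.level k).bdry_bdry,
      fun k => AddMonoidHom.ext fun x => ?_⟩
    · exact Subsingleton.elim _ _
    · rw [Subsingleton.elim x 0, map_zero, map_zero]
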